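/- Let $q\in(-1,1)$, put $a_q:=2/\sqrt{1-q}$, $(a;q)_\infty:=\prod_{k=0}^\infty(1-aq^k)$ and, for $x,y\in[-a_q,a_q]$ and $0\le s<t$, \[ p(x)=\frac{\sqrt{1-q}\,(q;q)_\infty}{2\pi}\sqrt{4-(1-q)x^2}\prod_{k=1}^\infty\big[(1+q^k)^2-(1-q)x^2q^k\big],\qquad p_{s,t}(x,y)=(e^{-2(t-s)};q)_\infty\prod_{k=0}^\infty\frac1{\varphi_{k}(t-s,x,y)}\;p(y), \] \[ \varphi_{k}(\delta,x,y)=(1-e^{-2\delta}q^{2k})^2-(1-q)e^{-\delta}q^k(1+e^{-2\delta}q^{2k})xy+(1-q)e^{-2\delta}q^{2k}(x^2+y^2). \] A $q$-Ornstein--Uhlenbeck process is a Markov process $X=(X_t)_{t\ge0}$ with càdlàg paths, all of whose marginals have density $p$ on $[-a_q,a_q]$ and whose transition densities are $p_{s,t}$. For $\epsilon>0$ and $i=1,2,\dots$ let $J_i(\epsilon)$ be the indicator of the event that there is $t\in(i-1,i]$ with $X_{t-}<-a_q+\epsilon$ and $X_t>a_q-\epsilon$; let $\mathcal J_1=\sigma(J_1(\epsilon))$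 and $\mathcal J_m^\infty=\sigma(J_k(\epsilon):k\ge m)$. There is a constant $C_q<\infty$, depending only on $q$, such that \[ \Big|\frac{p_{0,t}(x,y)}{p(y)}-1\Big|\le C_qe^{-t}\qquad\text{for all } t\ge1,\ x,y\in(-a_q,a_q), \] and such that, for every $q$-Ornstein--Uhlenbeck process $X$, the sequence $(J_i(\epsilon))_{i\ge1}$ is $\psi$-mixing in the sense that, almost surely, \[ |\mathbb P(B\mid\mathcal J_1)-\mathbb P(B)|\le C_qe^{-m}\,\mathbb P(B)\qquad\text{for all } B\in\mathcal J_{m+1}^\infty, \] for all integers $m\ge1$ and all $0<\epsilon<a_q$, and also for all $m\ge2$ and all $\epsilon\ge a_q$. -/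

import Mathlib

open MeasureTheory Filter Topology
open scoped NNReal

noncomputable section

namespace QOU

/-- The `q`-Pochhammer symbol `(a; q)_∞ = ∏_{k ≥ 0} (1 - a q ^ k)`. -/
def qPoch (a q : ℝ) : ℝ := ∏' k : ℕ, (1 - a * q ^ k)

/-- The right end point `2 / √(1 - q)` of the domain. -/
def endpt (q : ℝ) : ℝ := 2 / √(1 - q)

/-- The marginal density. The product over `k ≥ 1` is indexed by `k + 1`, `k : ℕ`.
Outside the domain `[-endpt q, endpt q]` the square root, hence the density, vanishes. -/
def dens (q x : ℝ) : ℝ :=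
  √(1 - q) * qPoch q q / (2 * Real.pi) * √(4 - (1 - q) * x ^ 2) *
    ∏' k : ℕ, ((1 + q ^ (k + 1)) ^ 2 - (1 - q) * x ^ 2 * q ^ (k + 1))

/-- The factors `φ_{q,k}(δ, x, y)` of the transition density. -/
def phi (q : ℝ) (k : ℕ) (δ x y : ℝ) : ℝ :=
  (1 - Real.exp (-2 * δ) * q ^ (2 * k)) ^ 2
    - (1 - q) * Real.exp (-δ) * q ^ k * (1 + Real.exp (-2 * δ) * q ^ (2 * k)) * x * y
    + (1 - q) * Real.exp (-2 * δ) * q ^ (2 * k) * (x ^ 2 + y ^ 2)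

/-- The transition density `p_{s,t}(x, y)`, for `s < t`. -/
def transDens (q s t x y : ℝ) : ℝ :=
  qPoch (Real.exp (-2 * (t - s))) q * (∏' k : ℕ, 1 / phi q k (t - s) x y) * dens q y

/-- Right-continuous functions with left limits on `[0, ∞)`. -/
def IsCadlag (f : ℝ≥0 → ℝ) : Prop :=
  ∀ t, ContinuousWithinAt f (Set.Ici t) t ∧ ∃ l, Tendsto f (𝓝[<] t) (𝓝 l)

/-- `X` is a `q`-Ornstein--Uhlenbeck process with paths in `D([0, ∞))`: every `X t` has the
density `dens q`, and `X` is Markov (with respect to its own past) with transition densities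
`transDens q s t`. -/
structure IsQOUProcess {Ω : Type*} [MeasurableSpace Ω] (q : ℝ) (X : ℝ≥0 → Ω → ℝ)
    (μ : Measure Ω) : Prop where
  measurable : ∀ t, Measurable (X t)
  cadlag : ∀ ω, IsCadlag (fun t => X t ω)
  marginal : ∀ t, μ.map (X t) = volume.withDensity (fun x => ENNReal.ofReal (dens q x))
  markov : ∀ s t : ℝ≥0, s < t → ∀ A : Set ℝ, MeasurableSet A →
    μ[(X t ⁻¹' A).indicator (fun _ => (1 : ℝ)) |
        ⨆ u ∈ Set.Iic s, MeasurableSpace.comap (X u) inferInstance]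
      =ᵐ[μ] fun ω => ∫ y in A, transDens q s t (X s ω) y

variable {Ω : Type*}

/-- The number `N((a, b], ε)` of big upward jumps in `(a, b]`, possibly infinite. -/
def bigJumps (q : ℝ) (X : ℝ≥0 → Ω → ℝ) (ε : ℝ) (a b : ℝ≥0) (ω : Ω) : ℕ∞ :=
  Set.encard {t ∈ Set.Ioc a b |
    Function.leftLim (fun s => X s ω) t < -endpt q + ε ∧ endpt q - ε < X t ω}

/-- The indicator `J_i(ε)` of at least one big jump in `(i - 1, i]`, for `i ≥ 1`. -/
def jumpInd (q : ℝ) (X : ℝ≥0 → Ω → ℝ) (ε : ℝ) (i : ℕ) : Ω → ℝ :=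
  {ω | 1 ≤ bigJumps q X ε ((i : ℝ≥0) - 1) i ω}.indicator (fun _ => 1)

/-- The σ-algebra generated by `J_1(ε)`. -/
abbrev sigmaOne (q : ℝ) (X : ℝ≥0 → Ω → ℝ) (ε : ℝ) : MeasurableSpace Ω :=
  MeasurableSpace.comap (jumpInd q X ε 1) inferInstance

/-- The σ-algebra generated by all `J_k(ε)` with `k ≥ m`. -/
abbrev sigmaFrom (q : ℝ) (X : ℝ≥0 → Ω → ℝ) (ε : ℝ) (m : ℕ) : MeasurableSpace Ω :=
  ⨆ k ∈ Set.Ici m, MeasurableSpace.comap (jumpInd q X ε k) inferInstance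

end QOU

end

noncomputable section

namespace QOU

open scoped ENNReal

set_option linter.unusedSectionVars false

/-! ### Infinite products with geometrically small factors -/

section Products

variable {f : ℕ → ℝ} {M θ m : ℝ}

/-! With respect to the stationary law π, whose density is `dens`, the transition kernel has a
symmetric density r(δ, x, y), written as the single infinite product `ratio`. For δ ≥ 1 its k-th
factor differs from 1 by at most a constant times e^{-δ}|q|^k, so |r − 1| ≤ C e^{-δ}
(`abs_ratio_sub_one_le`). By the Markov property, if G belongs to the past of s and H to the future
of t > s, then P(G ∩ H) is the integral of r(t − s, X_s(ω'), X_t(ω)) over ω' ∈ G and ω ∈ H under the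
product measure (`measure_inter_eq`). A bound on r − 1 is therefore at once a ψ-mixing bound. Since
J_1 lives on [0, 1] and the J_k with k > m live on [m, ∞), the gap is m − 1, which settles m ≥ 2.

For m = 1 the gap is zero and r is no longer bounded. But e^{-m} is then a constant, so it is enough
to prove P(G ∩ B) ≤ C P(G) P(B) for the two atoms G of σ(J_1).

The atom without a jump has probability bounded below, since a path that stays positive has no such
jump when ε < a_q. Staying positive on [0, 1] has positive probability: right continuity gives it on
a short interval, and reversibility with Cauchy–Schwarz doubles the interval at the cost of squaring
the probability (`stayProb_pos`). The resulting number is a functional of π and r only, hence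
depends only on q.

For the atom with a jump put b = a_q − ε and P = π(−∞, −b) π(b, ∞). If ε is not small, its
probability is bounded below. If ε is small, the point is that only the factor k = 0 of the product
degenerates as δ → 0, and it does not do so at points near opposite ends of the domain. Hence r lies
between multiples of δ at such points for δ ≤ 1. For small ε a jump in a half interval thus has
probability at least a multiple of P, while jumps in two adjacent half intervals have probability at
most a multiple of P². Splitting (0, 2] into half intervals, every case either leaves a gap of
length 1/2 or is such a double jump (`measureReal_jumpEvent_inter_split_le`). Estimates for jumps of
càdlàg paths come from dyadic grids (`hasJump_iff`). -/

lemma summable_of_le_geometric (hθ0 : 0 ≤ θ) (hθ1 : θ < 1)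
    (hf : ∀ k, |f k - 1| ≤ M * θ ^ k) : Summable fun k => ‖f k - 1‖ :=
  Summable.of_nonneg_of_le (fun _ => norm_nonneg _) hf
    ((summable_geometric_of_lt_one hθ0 hθ1).mul_left M)

lemma multipliable_of_le_geometric (hθ0 : 0 ≤ θ) (hθ1 : θ < 1)
    (hf : ∀ k, |f k - 1| ≤ M * θ ^ k) : Multipliable f := by
  have := multipliable_one_add_of_summable (summable_of_le_geometric hθ0 hθ1 hf)
  simpa using this

/-- Finite products satisfy |∏(1 + aₖ) − 1| ≤ exp(∑|aₖ|) − 1, and the geometric series bounds the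
sum uniformly in the number of factors. -/
lemma abs_tprod_sub_one_le (hθ0 : 0 ≤ θ) (hθ1 : θ < 1)
    (hf : ∀ k, |f k - 1| ≤ M * θ ^ k) :
    |∏' k, f k - 1| ≤ Real.exp (M / (1 - θ)) - 1 := by
  have h1 := ((multipliable_of_le_geometric hθ0 hθ1 hf).hasProd.tendsto_prod_nat.sub_const 1).abs
  refine le_of_tendsto' h1 fun n => ?_
  have h2 := Finset.norm_prod_one_add_sub_one_le (Finset.range n) (fun k => f k - 1)
  simp only [add_sub_cancel, Real.norm_eq_abs] at h2
  refine h2.trans ?_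
  gcongr
  calc ∑ k ∈ Finset.range n, |f k - 1| ≤ ∑ k ∈ Finset.range n, M * θ ^ k :=
        Finset.sum_le_sum fun k _ => hf k
    _ ≤ ∑' k, M * θ ^ k := by
        refine Summable.sum_le_tsum _ (fun k _ => (abs_nonneg _).trans (hf k))
          ((summable_geometric_of_lt_one hθ0 hθ1).mul_left M)
    _ = M / (1 - θ) := by rw [tsum_mul_left, tsum_geometric_of_lt_one hθ0 hθ1]; rfl

lemma tprod_le_exp (hθ0 : 0 ≤ θ) (hθ1 : θ < 1)
    (hf : ∀ k, |f k - 1| ≤ M * θ ^ k) : ∏' k, f k ≤ Real.exp (M / (1 - θ)) := by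
  linarith [(abs_le.1 (abs_tprod_sub_one_le hθ0 hθ1 hf)).2]

/-- The inverse factors obey the same geometric estimate with `M / m` in place of `M`, so the upper
bound for their product is a lower bound for the original one. -/
lemma exp_le_tprod (hθ0 : 0 ≤ θ) (hθ1 : θ < 1) (hf : ∀ k, |f k - 1| ≤ M * θ ^ k)
    (hm : 0 < m) (hfm : ∀ k, m ≤ f k) : Real.exp (-(M / m / (1 - θ))) ≤ ∏' k, f k := by
  have hpos : ∀ k, 0 < f k := fun k => hm.trans_le (hfm k)
  have hinv : ∀ k, |(f k)⁻¹ - 1| ≤ M / m * θ ^ k := by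
    intro k
    have : (f k)⁻¹ - 1 = -(f k - 1) / f k := by field_simp [(hpos k).ne']; ring
    rw [this, abs_div, abs_neg, abs_of_pos (hpos k)]
    calc |f k - 1| / f k ≤ (M * θ ^ k) / m :=
          div_le_div₀ ((abs_nonneg _).trans (hf k)) (hf k) hm (hfm k)
      _ = M / m * θ ^ k := by ring
  have h0 : 0 ≤ ∏' k, f k :=
    ge_of_tendsto' (multipliable_of_le_geometric hθ0 hθ1 hf).hasProd.tendsto_prod_nat
      fun n => Finset.prod_nonneg fun k _ => (hpos k).le
  have h1 : (∏' k, f k) * ∏' k, (f k)⁻¹ = 1 := by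
    rw [← Multipliable.tprod_mul (multipliable_of_le_geometric hθ0 hθ1 hf)
      (multipliable_of_le_geometric hθ0 hθ1 hinv)]
    simp [fun k => mul_inv_cancel₀ (hpos k).ne']
  have h2 := tprod_le_exp hθ0 hθ1 hinv
  rw [Real.exp_neg, inv_le_iff_one_le_mul₀ (Real.exp_pos _)]
  exact h1.ge.trans (mul_le_mul_of_nonneg_left h2 h0)

end Products

/-! ### The factors of the transition density -/

section Phi

variable {q : ℝ}

lemma abs_q_lt_one (hq : q ∈ Set.Ioo (-1 : ℝ) 1) : |q| < 1 := abs_lt.2 hq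

lemma one_sub_q_pos (hq : q ∈ Set.Ioo (-1 : ℝ) 1) : 0 < 1 - q := by linarith [hq.2]

lemma endpt_pos (hq : q ∈ Set.Ioo (-1 : ℝ) 1) : 0 < endpt q :=
  div_pos two_pos (Real.sqrt_pos.2 (one_sub_q_pos hq))

lemma endpt_sq (hq : q ∈ Set.Ioo (-1 : ℝ) 1) : (1 - q) * endpt q ^ 2 = 4 := by
  have := one_sub_q_pos hq
  rw [endpt, div_pow, Real.sq_sqrt this.le]
  field_simp
  norm_num

lemma scaled_sq_le {x : ℝ} (hq : q ∈ Set.Ioo (-1 : ℝ) 1)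
    (hx : x ∈ Set.Icc (-endpt q) (endpt q)) : (1 - q) * x ^ 2 ≤ 4 := by
  rw [← endpt_sq hq]
  exact mul_le_mul_of_nonneg_left (sq_le_sq' hx.1 hx.2) (one_sub_q_pos hq).le

/-- The factor `phi` as a polynomial in `ρ = e ^ (-δ) q ^ k`. -/
lemma phi_eq (k : ℕ) (δ x y : ℝ) {ρ : ℝ} (hρ : ρ = Real.exp (-δ) * q ^ k) :
    phi q k δ x y = (1 - ρ ^ 2) ^ 2 - ρ * (1 + ρ ^ 2) * ((1 - q) * x * y)
      + ρ ^ 2 * ((1 - q) * (x ^ 2 + y ^ 2)) := by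
  have h : Real.exp (-2 * δ) = Real.exp (-δ) ^ 2 := by
    rw [← Real.exp_nat_mul]; congr 1; push_cast; ring
  rw [phi, h, hρ]
  ring

lemma phi_symm (k : ℕ) (δ x y : ℝ) : phi q k δ x y = phi q k δ y x := by
  rw [phi, phi]; ring

/-- The difference of the two sides is exactly ρ(1 − ρ)²(4 − cxy), and cxy ≤ 4 on the domain. The
term in (x − y)² is what remains when ρ is near 1. -/
lemma poly_lower {c ρ x y : ℝ} (hx : c * x ^ 2 ≤ 4) (hy : c * y ^ 2 ≤ 4) (hc : 0 < c)
    (hρ : 0 ≤ ρ) :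
    (1 - ρ) ^ 4 + ρ ^ 2 * (c * (x - y) ^ 2) ≤
      (1 - ρ ^ 2) ^ 2 - ρ * (1 + ρ ^ 2) * (c * x * y) + ρ ^ 2 * (c * (x ^ 2 + y ^ 2)) := by
  have hxy : c * x * y ≤ 4 := by nlinarith [mul_nonneg hc.le (sq_nonneg (x - y))]
  have h : 0 ≤ ρ * (1 - ρ) ^ 2 * (4 - c * x * y) := by
    have : 0 ≤ 4 - c * x * y := by linarith
    positivity
  nlinarith [h]

/-- The polynomial is invariant under (ρ, y) ↦ (−ρ, −y), which reduces negative ρ to `poly_lower`.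
-/
lemma poly_lower_abs {c ρ x y : ℝ} (hx : c * x ^ 2 ≤ 4) (hy : c * y ^ 2 ≤ 4) (hc : 0 < c) :
    (1 - |ρ|) ^ 4 ≤
      (1 - ρ ^ 2) ^ 2 - ρ * (1 + ρ ^ 2) * (c * x * y) + ρ ^ 2 * (c * (x ^ 2 + y ^ 2)) := by
  rcases le_total 0 ρ with h | h
  · have := poly_lower hx hy hc h
    rw [abs_of_nonneg h]
    have h2 : 0 ≤ ρ ^ 2 * (c * (x - y) ^ 2) := by positivity
    linarith
  · have := poly_lower (ρ := -ρ) (y := -y) hx (by simpa using hy) hc (by linarith)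
    rw [abs_of_nonpos h]
    have h2 : 0 ≤ ρ ^ 2 * (c * (x + y) ^ 2) := by positivity
    nlinarith

lemma poly_sub_one {c ρ x y : ℝ} (hx : c * x ^ 2 ≤ 4) (hy : c * y ^ 2 ≤ 4) (hc : 0 < c)
    (hρ : |ρ| ≤ 1) :
    |(1 - ρ ^ 2) ^ 2 - ρ * (1 + ρ ^ 2) * (c * x * y) + ρ ^ 2 * (c * (x ^ 2 + y ^ 2)) - 1|
      ≤ 19 * |ρ| := by
  have hxy : |c * x * y| ≤ 4 := by
    rw [abs_le]
    constructor <;>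
      nlinarith [mul_nonneg hc.le (sq_nonneg (x - y)), mul_nonneg hc.le (sq_nonneg (x + y))]
  have hs : |c * (x ^ 2 + y ^ 2)| ≤ 8 := by
    rw [abs_of_nonneg (by positivity)]; linarith
  have h1 : ρ ^ 2 ≤ 1 := by rw [← sq_abs]; exact pow_le_one₀ (abs_nonneg _) hρ
  have e : (1 - ρ ^ 2) ^ 2 - ρ * (1 + ρ ^ 2) * (c * x * y) + ρ ^ 2 * (c * (x ^ 2 + y ^ 2)) - 1
      = ρ * (ρ * (ρ ^ 2 - 2) - (1 + ρ ^ 2) * (c * x * y) + ρ * (c * (x ^ 2 + y ^ 2))) := by ring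
  rw [e, abs_mul, mul_comm 19]
  refine mul_le_mul_of_nonneg_left ?_ (abs_nonneg _)
  have a1 : |ρ * (ρ ^ 2 - 2)| ≤ 2 := by
    rw [abs_mul]
    have : |ρ ^ 2 - 2| ≤ 2 := by rw [abs_le]; constructor <;> nlinarith [sq_nonneg ρ]
    nlinarith [abs_nonneg ρ, abs_nonneg (ρ ^ 2 - 2)]
  have a2 : |(1 + ρ ^ 2) * (c * x * y)| ≤ 8 := by
    rw [abs_mul, abs_of_nonneg (by positivity : 0 ≤ 1 + ρ ^ 2)]
    nlinarith [abs_nonneg (c * x * y)]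
  have a3 : |ρ * (c * (x ^ 2 + y ^ 2))| ≤ 8 := by
    rw [abs_mul]
    nlinarith [abs_nonneg ρ, abs_nonneg (c * (x ^ 2 + y ^ 2))]
  have a4 := abs_add_le (ρ * (ρ ^ 2 - 2) - (1 + ρ ^ 2) * (c * x * y)) (ρ * (c * (x ^ 2 + y ^ 2)))
  have a5 := abs_sub (ρ * (ρ ^ 2 - 2)) ((1 + ρ ^ 2) * (c * x * y))
  linarith

variable {δ x y : ℝ}

lemma abs_rho_le (k : ℕ) (hδ : 0 ≤ δ) : |Real.exp (-δ) * q ^ k| ≤ |q| ^ k := by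
  rw [abs_mul, abs_pow, abs_of_pos (Real.exp_pos _)]
  exact mul_le_of_le_one_left (by positivity) (Real.exp_le_one_iff.2 (by linarith))

lemma abs_phi_sub_one_le (hq : q ∈ Set.Ioo (-1 : ℝ) 1) (k : ℕ) (hδ : 0 ≤ δ)
    (hx : x ∈ Set.Icc (-endpt q) (endpt q)) (hy : y ∈ Set.Icc (-endpt q) (endpt q)) :
    |phi q k δ x y - 1| ≤ 19 * (Real.exp (-δ) * |q| ^ k) := by
  rw [phi_eq k δ x y rfl]
  refine (poly_sub_one (scaled_sq_le hq hx) (scaled_sq_le hq hy) (one_sub_q_pos hq) ?_).trans ?_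
  · exact (abs_rho_le k hδ).trans (pow_le_one₀ (abs_nonneg _) (abs_q_lt_one hq).le)
  · rw [abs_mul, abs_pow, abs_of_pos (Real.exp_pos _)]

lemma le_phi (hq : q ∈ Set.Ioo (-1 : ℝ) 1) (k : ℕ)
    (hx : x ∈ Set.Icc (-endpt q) (endpt q)) (hy : y ∈ Set.Icc (-endpt q) (endpt q)) :
    (1 - Real.exp (-δ) * |q| ^ k) ^ 4 ≤ phi q k δ x y := by
  rw [phi_eq k δ x y rfl]
  convert poly_lower_abs (scaled_sq_le hq hx) (scaled_sq_le hq hy) (one_sub_q_pos hq) using 3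
  rw [abs_mul, abs_pow, abs_of_pos (Real.exp_pos _)]

lemma le_phi_succ (hq : q ∈ Set.Ioo (-1 : ℝ) 1) (k : ℕ) (hδ : 0 ≤ δ)
    (hx : x ∈ Set.Icc (-endpt q) (endpt q)) (hy : y ∈ Set.Icc (-endpt q) (endpt q)) :
    (1 - |q|) ^ 4 ≤ phi q (k + 1) δ x y := by
  refine le_trans ?_ (le_phi hq (k + 1) hx hy)
  have h1 := abs_q_lt_one hq
  refine pow_le_pow_left₀ (by linarith) ?_ 4
  have : Real.exp (-δ) * |q| ^ (k + 1) ≤ |q| := by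
    calc Real.exp (-δ) * |q| ^ (k + 1) ≤ |q| ^ (k + 1) :=
          mul_le_of_le_one_left (by positivity) (Real.exp_le_one_iff.2 (by linarith))
      _ ≤ |q| := pow_le_of_le_one (abs_nonneg _) h1.le (Nat.succ_ne_zero k)
  linarith

lemma phi_zero_le (hq : q ∈ Set.Ioo (-1 : ℝ) 1) (hδ : 0 ≤ δ)
    (hx : x ∈ Set.Icc (-endpt q) (endpt q)) (hy : y ∈ Set.Icc (-endpt q) (endpt q)) :
    phi q 0 δ x y ≤ 20 := by
  have h := (abs_le.1 (abs_phi_sub_one_le hq 0 hδ hx hy)).2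
  have : Real.exp (-δ) ≤ 1 := Real.exp_le_one_iff.2 (by linarith)
  simp only [pow_zero, mul_one] at h
  linarith

/-- For ρ ≤ 1/2 the term (1 − ρ)^4 suffices; for ρ ≥ 1/2 the separation gives (1 − q)(x − y)² ≥ 4.
So at separated points the factor k = 0 stays away from zero even as δ → 0. -/
lemma le_phi_zero_of_far (hq : q ∈ Set.Ioo (-1 : ℝ) 1)
    (hx : x ∈ Set.Icc (-endpt q) (endpt q)) (hy : y ∈ Set.Icc (-endpt q) (endpt q))
    (hxy : endpt q ≤ |x - y|) : 1 / 16 ≤ phi q 0 δ x y := by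
  rw [phi_eq 0 δ x y rfl]
  have h0 := one_sub_q_pos hq
  set ρ := Real.exp (-δ) * q ^ 0 with hρ
  have hρ0 : 0 ≤ ρ := by rw [hρ]; simp [Real.exp_nonneg]
  refine le_trans ?_ (poly_lower (scaled_sq_le hq hx) (scaled_sq_le hq hy) h0 hρ0)
  have hd : 4 ≤ (1 - q) * (x - y) ^ 2 := by
    rw [← endpt_sq hq, ← sq_abs (x - y)]
    exact mul_le_mul_of_nonneg_left (pow_le_pow_left₀ (endpt_pos hq).le hxy 2) h0.le
  rcases le_total ρ (1 / 2) with h | h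
  · have : (1 / 2 : ℝ) ^ 4 ≤ (1 - ρ) ^ 4 := pow_le_pow_left₀ (by norm_num) (by linarith) 4
    have h2 : 0 ≤ ρ ^ 2 * ((1 - q) * (x - y) ^ 2) := by positivity
    norm_num at this
    linarith
  · have : 0 ≤ (1 - ρ) ^ 4 := by positivity
    nlinarith

end Phi

/-! ### The density ratio -/

/-- The ratio `p_{0,δ}(x, y) / p(y)` as a single infinite product. -/
def ratio (q δ x y : ℝ) : ℝ := ∏' k : ℕ, (1 - Real.exp (-2 * δ) * q ^ k) / phi q k δ x y

section Ratio

variable {q δ x y : ℝ}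

lemma exp_neg_two_le (hδ : 0 ≤ δ) : Real.exp (-2 * δ) ≤ Real.exp (-δ) :=
  Real.exp_le_exp.2 (by linarith)

lemma abs_numer_sub_phi_le (hq : q ∈ Set.Ioo (-1 : ℝ) 1) (k : ℕ) (hδ : 0 ≤ δ)
    (hx : x ∈ Set.Icc (-endpt q) (endpt q)) (hy : y ∈ Set.Icc (-endpt q) (endpt q)) :
    |(1 - Real.exp (-2 * δ) * q ^ k) - phi q k δ x y| ≤ 20 * (Real.exp (-δ) * |q| ^ k) := by
  have h1 := abs_phi_sub_one_le hq k hδ hx hy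
  have h2 : |Real.exp (-2 * δ) * q ^ k| ≤ Real.exp (-δ) * |q| ^ k := by
    rw [abs_mul, abs_pow, abs_of_pos (Real.exp_pos _)]
    exact mul_le_mul_of_nonneg_right (exp_neg_two_le hδ) (by positivity)
  have h3 := abs_add_le (-(Real.exp (-2 * δ) * q ^ k)) (-(phi q k δ x y - 1))
  rw [abs_neg, abs_neg] at h3
  calc _ = |-(Real.exp (-2 * δ) * q ^ k) + -(phi q k δ x y - 1)| := by congr 1; ring
    _ ≤ _ := by linarith

lemma abs_factor_sub_one_le {m : ℝ} (hq : q ∈ Set.Ioo (-1 : ℝ) 1) (k : ℕ) (hδ : 0 ≤ δ)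
    (hx : x ∈ Set.Icc (-endpt q) (endpt q)) (hy : y ∈ Set.Icc (-endpt q) (endpt q))
    (hm : 0 < m) (hφ : m ≤ phi q k δ x y) :
    |(1 - Real.exp (-2 * δ) * q ^ k) / phi q k δ x y - 1|
      ≤ 20 / m * Real.exp (-δ) * |q| ^ k := by
  have hpos := hm.trans_le hφ
  rw [div_sub_one hpos.ne', abs_div, abs_of_pos hpos]
  calc _ ≤ (20 * (Real.exp (-δ) * |q| ^ k)) / m :=
        div_le_div₀ (by positivity) (abs_numer_sub_phi_le hq k hδ hx hy) hm hφ
    _ = _ := by ring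

lemma one_sub_exp_pos (hδ : 0 < δ) : 0 < 1 - Real.exp (-δ) := by
  have : Real.exp (-δ) < 1 := by
    rw [Real.exp_lt_one_iff]; linarith
  linarith

/-- A common positive lower bound for all factors at time `δ`. -/
lemma min_le_phi (hq : q ∈ Set.Ioo (-1 : ℝ) 1) (k : ℕ) (hδ : 0 ≤ δ)
    (hx : x ∈ Set.Icc (-endpt q) (endpt q)) (hy : y ∈ Set.Icc (-endpt q) (endpt q)) :
    min ((1 - Real.exp (-δ)) ^ 4) ((1 - |q|) ^ 4) ≤ phi q k δ x y := by
  cases k with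
  | zero => exact (min_le_left _ _).trans (by simpa using le_phi (δ := δ) hq 0 hx hy)
  | succ k => exact (min_le_right _ _).trans (le_phi_succ hq k hδ hx hy)

lemma min_pos (hq : q ∈ Set.Ioo (-1 : ℝ) 1) (hδ : 0 < δ) :
    0 < min ((1 - Real.exp (-δ)) ^ 4) ((1 - |q|) ^ 4) :=
  lt_min (pow_pos (one_sub_exp_pos hδ) 4) (pow_pos (by linarith [abs_q_lt_one hq]) 4)

lemma multipliable_ratio (hq : q ∈ Set.Ioo (-1 : ℝ) 1) (hδ : 0 < δ)
    (hx : x ∈ Set.Icc (-endpt q) (endpt q)) (hy : y ∈ Set.Icc (-endpt q) (endpt q)) :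
    Multipliable fun k : ℕ => (1 - Real.exp (-2 * δ) * q ^ k) / phi q k δ x y :=
  multipliable_of_le_geometric (abs_nonneg q) (abs_q_lt_one hq) fun k =>
    abs_factor_sub_one_le hq k hδ.le hx hy (min_pos hq hδ) (min_le_phi hq k hδ.le hx hy)

lemma qPoch_mul_tprod_eq_ratio (hq : q ∈ Set.Ioo (-1 : ℝ) 1) (hδ : 0 < δ)
    (hx : x ∈ Set.Icc (-endpt q) (endpt q)) (hy : y ∈ Set.Icc (-endpt q) (endpt q)) :
    qPoch (Real.exp (-2 * δ)) q * ∏' k : ℕ, 1 / phi q k δ x y = ratio q δ x y := by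
  rw [qPoch, ratio, ← Multipliable.tprod_mul]
  · simp only [mul_one_div]
  · refine multipliable_of_le_geometric (M := 1) (abs_nonneg q) (abs_q_lt_one hq) fun k => ?_
    rw [sub_sub_cancel_left, abs_neg, abs_mul, abs_pow, abs_of_pos (Real.exp_pos _)]
    exact mul_le_mul_of_nonneg_right (Real.exp_le_one_iff.2 (by linarith)) (by positivity)
  · set m := min ((1 - Real.exp (-δ)) ^ 4) ((1 - |q|) ^ 4)
    refine multipliable_of_le_geometric (M := 19 / m) (abs_nonneg q) (abs_q_lt_one hq)
      fun k => ?_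
    have hm : 0 < m := min_pos hq hδ
    have hφ : m ≤ phi q k δ x y := min_le_phi hq k hδ.le hx hy
    have hpos := hm.trans_le hφ
    rw [div_sub_one hpos.ne', abs_div, abs_of_pos hpos, abs_sub_comm]
    calc _ ≤ (19 * (1 * |q| ^ k)) / m := by
          refine div_le_div₀ (by positivity)
            ((abs_phi_sub_one_le hq k hδ.le hx hy).trans ?_) hm hφ
          gcongr
          exact Real.exp_le_one_iff.2 (by linarith)
      _ = _ := by ring

lemma ratio_symm (q δ x y : ℝ) : ratio q δ x y = ratio q δ y x := by
  simp only [ratio, phi_symm _ _ x y]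

lemma half_le_one_sub_exp (hδ : 1 ≤ δ) : 1 / 2 ≤ 1 - Real.exp (-δ) := by
  have h1 : Real.exp (-δ) ≤ Real.exp (-1) := Real.exp_le_exp.2 (by linarith)
  have h2 := Real.exp_neg_one_lt_d9
  linarith

/-- The constant in the convergence of the ratio to one. -/
def mixConst (q : ℝ) : ℝ :=
  20 / min (1 / 16) ((1 - |q|) ^ 4) / (1 - |q|) *
    Real.exp (20 / min (1 / 16) ((1 - |q|) ^ 4) / (1 - |q|))

lemma abs_ratio_sub_one_le (hq : q ∈ Set.Ioo (-1 : ℝ) 1) (hδ : 1 ≤ δ)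
    (hx : x ∈ Set.Icc (-endpt q) (endpt q)) (hy : y ∈ Set.Icc (-endpt q) (endpt q)) :
    |ratio q δ x y - 1| ≤ mixConst q * Real.exp (-δ) := by
  have hq1 := abs_q_lt_one hq
  set m := min (1 / 16 : ℝ) ((1 - |q|) ^ 4) with hm
  have hm0 : 0 < m := lt_min (by norm_num) (pow_pos (by linarith) 4)
  have hφ : ∀ k, m ≤ phi q k δ x y := fun k => by
    refine le_trans ?_ (min_le_phi hq k (by linarith) hx hy)
    refine min_le_min_right _ ?_
    calc (1 / 16 : ℝ) = (1 / 2) ^ 4 := by norm_num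
      _ ≤ _ := pow_le_pow_left₀ (by norm_num) (half_le_one_sub_exp hδ) 4
  have h := abs_tprod_sub_one_le (abs_nonneg q) hq1 fun k =>
    abs_factor_sub_one_le hq k (by linarith) hx hy hm0 (hφ k)
  rw [ratio]
  refine h.trans ?_
  set S := 20 / m / (1 - |q|) with hS
  have hS0 : 0 ≤ S := by have : 0 < 1 - |q| := by linarith
                         positivity
  have e : 20 / m * Real.exp (-δ) / (1 - |q|) = S * Real.exp (-δ) := by rw [hS]; ring
  rw [e]
  -- Since z ≤ S, the bound e^z − 1 ≤ z e^z ≤ z e^S is linear in e^{-δ}; this is the origin of the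
  -- form S e^S of `mixConst`.
  set z := S * Real.exp (-δ) with hz
  have hz0 : 0 ≤ z := by positivity
  have hzS : z ≤ S := mul_le_of_le_one_right hS0 (Real.exp_le_one_iff.2 (by linarith))
  have h3 : 1 - z ≤ Real.exp (-z) := by linarith [Real.add_one_le_exp (-z)]
  have h4 : Real.exp z - 1 ≤ z * Real.exp z := by
    have : Real.exp z * (1 - z) ≤ Real.exp z * Real.exp (-z) :=
      mul_le_mul_of_nonneg_left h3 (Real.exp_pos _).le
    rw [← Real.exp_add] at this
    simp at this
    linarith
  calc Real.exp z - 1 ≤ z * Real.exp z := h4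
    _ ≤ z * Real.exp S := by gcongr
    _ = S * Real.exp S * Real.exp (-δ) := by rw [hz]; ring

/-- The parameter e^{-δ}q^k has modulus at most |q| < 1 for k ≥ 1, so only the factor k = 0 can
degenerate as δ → 0; it is split off. -/
lemma ratio_eq_zero_mul (hq : q ∈ Set.Ioo (-1 : ℝ) 1) (hδ : 0 ≤ δ)
    (hx : x ∈ Set.Icc (-endpt q) (endpt q)) (hy : y ∈ Set.Icc (-endpt q) (endpt q)) :
    ratio q δ x y = (1 - Real.exp (-2 * δ)) / phi q 0 δ x y *
      ∏' k : ℕ, (1 - Real.exp (-2 * δ) * q ^ (k + 1)) / phi q (k + 1) δ x y := by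
  have hq1 : 0 < 1 - |q| := by linarith [abs_q_lt_one hq]
  rw [ratio, tprod_eq_zero_mul']
  · simp
  · refine multipliable_of_le_geometric (M := 20 / (1 - |q|) ^ 4 * Real.exp (-δ) * |q|)
      (abs_nonneg q) (abs_q_lt_one hq) fun k => ?_
    refine (abs_factor_sub_one_le hq (k + 1) hδ hx hy (pow_pos hq1 4)
      (le_phi_succ hq k hδ hx hy)).trans (le_of_eq (by ring))

/-- For k ≥ 1 the denominators lie between (1 − |q|)^4 and 20 and the numerators are at least 1 −
|q|, all uniformly down to δ = 0. -/
lemma tail_bounds (hq : q ∈ Set.Ioo (-1 : ℝ) 1) :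
    ∃ c C : ℝ, 0 < c ∧ 0 < C ∧ ∀ δ : ℝ, 0 ≤ δ → ∀ x ∈ Set.Icc (-endpt q) (endpt q),
      ∀ y ∈ Set.Icc (-endpt q) (endpt q),
      c ≤ ∏' k : ℕ, (1 - Real.exp (-2 * δ) * q ^ (k + 1)) / phi q (k + 1) δ x y ∧
      ∏' k : ℕ, (1 - Real.exp (-2 * δ) * q ^ (k + 1)) / phi q (k + 1) δ x y ≤ C := by
  have hq1 : 0 < 1 - |q| := by linarith [abs_q_lt_one hq]
  refine ⟨Real.exp (-(20 / (1 - |q|) ^ 4 / ((1 - |q|) / 20) / (1 - |q|))),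
    Real.exp (20 / (1 - |q|) ^ 4 / (1 - |q|)), Real.exp_pos _, Real.exp_pos _, ?_⟩
  intro δ hδ x hx y hy
  have hf : ∀ k : ℕ, |(1 - Real.exp (-2 * δ) * q ^ (k + 1)) / phi q (k + 1) δ x y - 1|
      ≤ 20 / (1 - |q|) ^ 4 * |q| ^ k := fun k => by
    refine (abs_factor_sub_one_le hq (k + 1) hδ hx hy (pow_pos hq1 4)
      (le_phi_succ hq k hδ hx hy)).trans ?_
    refine mul_le_mul ?_ ?_ (by positivity) (by positivity)
    · exact mul_le_of_le_one_right (by positivity) (Real.exp_le_one_iff.2 (by linarith))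
    · exact pow_le_pow_of_le_one (abs_nonneg _) (abs_q_lt_one hq).le (Nat.le_succ k)
  refine ⟨exp_le_tprod (abs_nonneg q) (abs_q_lt_one hq) hf (by positivity) fun k => ?_,
    tprod_le_exp (abs_nonneg q) (abs_q_lt_one hq) hf⟩
  have hpos : 0 < phi q (k + 1) δ x y := (pow_pos hq1 4).trans_le (le_phi_succ hq k hδ hx hy)
  have hpow : Real.exp (-δ) * |q| ^ (k + 1) ≤ |q| := by
    calc Real.exp (-δ) * |q| ^ (k + 1) ≤ |q| ^ (k + 1) :=
          mul_le_of_le_one_left (by positivity) (Real.exp_le_one_iff.2 (by linarith))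
      _ ≤ |q| := pow_le_of_le_one (abs_nonneg _) (abs_q_lt_one hq).le (Nat.succ_ne_zero k)
  have h20 : phi q (k + 1) δ x y ≤ 20 := by
    have h := (abs_le.1 (abs_phi_sub_one_le hq (k + 1) hδ hx hy)).2
    linarith
  have hnum : 1 - |q| ≤ 1 - Real.exp (-2 * δ) * q ^ (k + 1) := by
    have : Real.exp (-2 * δ) * q ^ (k + 1) ≤ Real.exp (-δ) * |q| ^ (k + 1) := by
      calc Real.exp (-2 * δ) * q ^ (k + 1) ≤ Real.exp (-2 * δ) * |q| ^ (k + 1) := by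
            rw [← abs_pow]
            exact mul_le_mul_of_nonneg_left (le_abs_self _) (Real.exp_pos _).le
        _ ≤ _ := mul_le_mul_of_nonneg_right (exp_neg_two_le hδ) (by positivity)
    linarith
  rw [le_div_iff₀ hpos]
  nlinarith

/-- Uniform two-sided bounds for the ratio. -/
lemma ratio_bounds (hq : q ∈ Set.Ioo (-1 : ℝ) 1) :
    ∃ c C : ℝ, 0 < c ∧ 0 < C ∧ ∀ δ : ℝ, 0 ≤ δ → ∀ x ∈ Set.Icc (-endpt q) (endpt q),
      ∀ y ∈ Set.Icc (-endpt q) (endpt q),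
      (δ ≤ 1 → c * δ ≤ ratio q δ x y) ∧
      (1 / 2 ≤ δ → ratio q δ x y ≤ C) ∧
      (endpt q ≤ |x - y| → ratio q δ x y ≤ C * δ ∧ ratio q δ x y ≤ C) := by
  obtain ⟨c, C, hc, hC, h⟩ := tail_bounds hq
  have hhalf : 0 < 1 - Real.exp (-(1 / 2 : ℝ)) := one_sub_exp_pos (by norm_num)
  -- The lower constant comes from 1 − e^{-2δ} ≥ δ/2 for δ ≤ 1 and φ₀ ≤ 20. In the upper one, 32 =
  -- 16 · 2 serves separated points, where 1/φ₀ ≤ 16 and 1 − e^{-2δ} ≤ 2δ; the other summand serves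
  -- δ ≥ 1/2.
  refine ⟨c / 20 / 2, C * 32 + C / (1 - Real.exp (-(1 / 2 : ℝ))) ^ 4, by positivity,
    by positivity, fun δ hδ x hx y hy => ?_⟩
  obtain ⟨h1, h2⟩ := h δ hδ x hx y hy
  rw [ratio_eq_zero_mul hq hδ hx hy]
  set T := ∏' k : ℕ, (1 - Real.exp (-2 * δ) * q ^ (k + 1)) / phi q (k + 1) δ x y
  have hT0 : 0 ≤ T := hc.le.trans h1
  have hn0 : 0 ≤ 1 - Real.exp (-2 * δ) := by
    have : Real.exp (-2 * δ) ≤ 1 := Real.exp_le_one_iff.2 (by linarith)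
    linarith
  have hn1 : 1 - Real.exp (-2 * δ) ≤ 1 := by linarith [Real.exp_pos (-2 * δ)]
  have hn2 : 1 - Real.exp (-2 * δ) ≤ 2 * δ := by linarith [Real.add_one_le_exp (-2 * δ)]
  have hφ4 := le_phi (δ := δ) hq 0 hx hy
  simp only [pow_zero, mul_one] at hφ4
  have hdiv : 0 ≤ C / (1 - Real.exp (-(1 / 2 : ℝ))) ^ 4 := by positivity
  refine ⟨fun hδ1 => ?_, fun hδ1 => ?_, fun hfar => ?_⟩
  · rcases hδ.eq_or_lt with rfl | hpos
    · simp
    have hφpos : 0 < phi q 0 δ x y := (pow_pos (one_sub_exp_pos hpos) 4).trans_le hφ4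
    have hlow : δ / 2 ≤ 1 - Real.exp (-2 * δ) := by
      have h3 : Real.exp (-2 * δ) ≤ Real.exp (-δ) := exp_neg_two_le hδ
      have h4 : Real.exp (-δ) ≤ 1 / (1 + δ) := by
        rw [Real.exp_neg, inv_eq_one_div]
        exact one_div_le_one_div_of_le (by linarith) (by linarith [Real.add_one_le_exp δ])
      have h5 : 1 / (1 + δ) ≤ 1 - δ / 2 := by
        rw [div_le_iff₀ (by linarith)]; nlinarith
      linarith
    calc c / 20 / 2 * δ = (δ / 2) / 20 * c := by ring
      _ ≤ (1 - Real.exp (-2 * δ)) / phi q 0 δ x y * T := by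
        refine mul_le_mul (div_le_div₀ hn0 hlow hφpos (phi_zero_le hq hδ hx hy)) h1 hc.le ?_
        positivity
  · have hmono : (1 - Real.exp (-(1 / 2 : ℝ))) ^ 4 ≤ phi q 0 δ x y := by
      refine le_trans (pow_le_pow_left₀ hhalf.le ?_ 4) hφ4
      have : Real.exp (-δ) ≤ Real.exp (-(1 / 2 : ℝ)) := Real.exp_le_exp.2 (by linarith)
      linarith
    calc _ ≤ 1 / (1 - Real.exp (-(1 / 2 : ℝ))) ^ 4 * C := by
          refine mul_le_mul (div_le_div₀ zero_le_one hn1 (pow_pos hhalf 4) hmono) h2 hT0 ?_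
          positivity
      _ = C / (1 - Real.exp (-(1 / 2 : ℝ))) ^ 4 := by ring
      _ ≤ _ := by linarith
  · have hφ := le_phi_zero_of_far (δ := δ) hq hx hy hfar
    have key : ∀ b : ℝ, 0 ≤ b → 1 - Real.exp (-2 * δ) ≤ b →
        (1 - Real.exp (-2 * δ)) / phi q 0 δ x y * T ≤ 16 * b * C := fun b hb hnb => by
      calc _ ≤ b / (1 / 16) * C := by
            refine mul_le_mul (div_le_div₀ hb hnb (by norm_num) hφ) h2 hT0 ?_
            positivity
        _ = _ := by ring
    constructor
    · have := key (2 * δ) (by linarith) hn2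
      nlinarith [mul_nonneg hdiv hδ]
    · have := key 1 zero_le_one hn1
      linarith

lemma ratio_nonneg (hq : q ∈ Set.Ioo (-1 : ℝ) 1) (hδ : 0 ≤ δ)
    (hx : x ∈ Set.Icc (-endpt q) (endpt q)) (hy : y ∈ Set.Icc (-endpt q) (endpt q)) :
    0 ≤ ratio q δ x y := by
  obtain ⟨c, C, hc, hC, h⟩ := tail_bounds hq
  rw [ratio_eq_zero_mul hq hδ hx hy]
  have h1 := (h δ hδ x hx y hy).1
  have hφ4 := le_phi (δ := δ) hq 0 hx hy
  simp only [pow_zero, mul_one] at hφ4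
  have : Real.exp (-2 * δ) ≤ 1 := Real.exp_le_one_iff.2 (by linarith)
  refine mul_nonneg (div_nonneg (by linarith) (le_trans ?_ hφ4)) (hc.le.trans h1)
  exact Even.pow_nonneg (by decide) _

lemma ratio_le_of_pos (hq : q ∈ Set.Ioo (-1 : ℝ) 1) (hδ : 0 < δ) :
    ∃ C : ℝ, ∀ x ∈ Set.Icc (-endpt q) (endpt q), ∀ y ∈ Set.Icc (-endpt q) (endpt q),
      ratio q δ x y ≤ C :=
  ⟨_, fun _ hx _ hy => tprod_le_exp (abs_nonneg q) (abs_q_lt_one hq) fun k =>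
    abs_factor_sub_one_le hq k hδ.le hx hy (min_pos hq hδ) (min_le_phi hq k hδ.le hx hy)⟩

end Ratio

/-! ### The marginal density -/

section Dens

variable {q x : ℝ}

lemma abs_dens_factor_sub_one_le (hq : q ∈ Set.Ioo (-1 : ℝ) 1) (x : ℝ) (k : ℕ) :
    |(1 + q ^ (k + 1)) ^ 2 - (1 - q) * x ^ 2 * q ^ (k + 1) - 1|
      ≤ (3 + (1 - q) * x ^ 2) * |q| ^ k := by
  have h0 := one_sub_q_pos hq
  have hQ : |q ^ (k + 1)| ≤ |q| ^ k := by
    rw [abs_pow]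
    exact pow_le_pow_of_le_one (abs_nonneg _) (abs_q_lt_one hq).le (Nat.le_succ k)
  have hQ1 : |q ^ (k + 1)| ≤ 1 := hQ.trans (pow_le_one₀ (abs_nonneg _) (abs_q_lt_one hq).le)
  set Q := q ^ (k + 1)
  have e : (1 + Q) ^ 2 - (1 - q) * x ^ 2 * Q - 1 = (2 + Q - (1 - q) * x ^ 2) * Q := by ring
  rw [e, abs_mul]
  refine mul_le_mul ?_ hQ (abs_nonneg _) (by positivity)
  have h1 : 0 ≤ (1 - q) * x ^ 2 := by positivity
  have h2 := abs_le.1 hQ1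
  rw [abs_le]
  constructor <;> linarith

lemma multipliable_dens (hq : q ∈ Set.Ioo (-1 : ℝ) 1) (x : ℝ) :
    Multipliable fun k : ℕ => (1 + q ^ (k + 1)) ^ 2 - (1 - q) * x ^ 2 * q ^ (k + 1) :=
  multipliable_of_le_geometric (abs_nonneg q) (abs_q_lt_one hq)
    (abs_dens_factor_sub_one_le hq x)

lemma measurable_dens (hq : q ∈ Set.Ioo (-1 : ℝ) 1) : Measurable (dens q) := by
  have h : Measurable fun x : ℝ =>
      ∏' k : ℕ, ((1 + q ^ (k + 1)) ^ 2 - (1 - q) * x ^ 2 * q ^ (k + 1)) := by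
    refine measurable_of_tendsto_metrizable (f := fun n x => ∏ k ∈ Finset.range n,
      ((1 + q ^ (k + 1)) ^ 2 - (1 - q) * x ^ 2 * q ^ (k + 1))) (fun n => ?_) ?_
    · fun_prop
    · rw [tendsto_pi_nhds]
      exact fun x => (multipliable_dens hq x).hasProd.tendsto_prod_nat
  unfold dens
  exact (by fun_prop : Measurable fun x : ℝ => √(1 - q) * qPoch q q / (2 * Real.pi) *
    √(4 - (1 - q) * x ^ 2)).mul h

lemma qPoch_self_pos (hq : q ∈ Set.Ioo (-1 : ℝ) 1) : 0 < qPoch q q := by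
  have hq1 : 0 < 1 - |q| := by linarith [abs_q_lt_one hq]
  refine (Real.exp_pos _).trans_le (exp_le_tprod (M := |q|) (m := 1 - |q|) (abs_nonneg q)
    (abs_q_lt_one hq) (fun k => ?_) hq1 fun k => ?_)
  · rw [sub_sub_cancel_left, abs_neg, abs_mul, abs_pow]
  · have : |q * q ^ k| ≤ |q| := by
      rw [abs_mul, abs_pow]
      exact mul_le_of_le_one_right (abs_nonneg _) (pow_le_one₀ (abs_nonneg _) (abs_q_lt_one hq).le)
    linarith [le_abs_self (q * q ^ k)]

lemma dens_pos (hq : q ∈ Set.Ioo (-1 : ℝ) 1) (hx : x ∈ Set.Ioo (-endpt q) (endpt q)) :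
    0 < dens q x := by
  have hq1 : 0 < 1 - |q| := by linarith [abs_q_lt_one hq]
  have h0 := one_sub_q_pos hq
  have hx4 : (1 - q) * x ^ 2 < 4 := by
    rw [← endpt_sq hq]
    exact mul_lt_mul_of_pos_left (sq_lt_sq' hx.1 hx.2) h0
  have hs : 0 < √(4 - (1 - q) * x ^ 2) := Real.sqrt_pos.2 (by linarith)
  have hs' : 0 < √(1 - q) := Real.sqrt_pos.2 h0
  have hP := qPoch_self_pos hq
  have hprod : 0 < ∏' k : ℕ, ((1 + q ^ (k + 1)) ^ 2 - (1 - q) * x ^ 2 * q ^ (k + 1)) := by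
    refine (Real.exp_pos _).trans_le (exp_le_tprod (m := (1 - |q|) ^ 2) (abs_nonneg q)
      (abs_q_lt_one hq) (abs_dens_factor_sub_one_le hq x) (by positivity) fun k => ?_)
    have hQ : |q ^ (k + 1)| ≤ |q| := by
      rw [abs_pow]
      exact pow_le_of_le_one (abs_nonneg _) (abs_q_lt_one hq).le (Nat.succ_ne_zero k)
    set Q := q ^ (k + 1)
    have h1 : (1 - |q|) ^ 2 ≤ (1 - |Q|) ^ 2 := pow_le_pow_left₀ hq1.le (by linarith) 2
    have h2 : 0 ≤ (1 - q) * x ^ 2 := by positivity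
    refine h1.trans ?_
    -- For Q ≥ 0 the factor is at least (1 + Q)² − 4Q = (1 − Q)²; for Q ≤ 0 the subtracted term only
    -- helps.
    rcases le_total 0 Q with h | h
    · rw [abs_of_nonneg h]; nlinarith
    · rw [abs_of_nonpos h]; nlinarith
  unfold dens
  positivity

lemma dens_eq_zero (hq : q ∈ Set.Ioo (-1 : ℝ) 1) (hx : x ∉ Set.Ioo (-endpt q) (endpt q)) :
    dens q x = 0 := by
  have h : 4 ≤ (1 - q) * x ^ 2 := by
    rw [← endpt_sq hq, ← sq_abs x]
    refine mul_le_mul_of_nonneg_left (pow_le_pow_left₀ (endpt_pos hq).le ?_ 2)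
      (one_sub_q_pos hq).le
    by_contra hlt
    exact hx (abs_lt.1 (not_le.1 hlt))
  have h' : √(4 - (1 - q) * x ^ 2) = 0 := Real.sqrt_eq_zero_of_nonpos (by linarith)
  rw [dens, h']
  simp

lemma dens_nonneg (hq : q ∈ Set.Ioo (-1 : ℝ) 1) (x : ℝ) : 0 ≤ dens q x := by
  by_cases hx : x ∈ Set.Ioo (-endpt q) (endpt q)
  · exact (dens_pos hq hx).le
  · exact (dens_eq_zero hq hx).ge

end Dens

/-! ### The ratio extended to the whole line -/

/-- The nearest point of the domain. -/
def clamp (q x : ℝ) : ℝ := max (-endpt q) (min x (endpt q))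

/-- The ratio `p_{0,δ}(x, y) / p(y)`, extended by clamping both variables to the domain. -/
def rat (q δ x y : ℝ) : ℝ := ratio q δ (clamp q x) (clamp q y)

section Rat

variable {q δ x y : ℝ}

lemma clamp_mem (hq : q ∈ Set.Ioo (-1 : ℝ) 1) (x : ℝ) :
    clamp q x ∈ Set.Icc (-endpt q) (endpt q) :=
  ⟨le_max_left _ _, max_le (by linarith [endpt_pos hq]) (min_le_right _ _)⟩

lemma clamp_of_mem (hx : x ∈ Set.Icc (-endpt q) (endpt q)) : clamp q x = x := by
  rw [clamp, min_eq_left hx.2, max_eq_right hx.1]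

lemma measurable_rat (hq : q ∈ Set.Ioo (-1 : ℝ) 1) (hδ : 0 < δ) :
    Measurable fun z : ℝ × ℝ => rat q δ z.1 z.2 := by
  refine measurable_of_tendsto_metrizable (f := fun n (z : ℝ × ℝ) => ∏ k ∈ Finset.range n,
    (1 - Real.exp (-2 * δ) * q ^ k) / phi q k δ (clamp q z.1) (clamp q z.2)) (fun n => ?_) ?_
  · refine Finset.measurable_fun_prod _ fun k _ => ?_
    unfold phi clamp
    fun_prop
  · rw [tendsto_pi_nhds]
    exact fun z =>
      (multipliable_ratio hq hδ (clamp_mem hq _) (clamp_mem hq _)).hasProd.tendsto_prod_nat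

/-- No condition on `y` is needed, because `dens` vanishes off the open domain. -/
lemma transDens_eq {s t : ℝ} (hq : q ∈ Set.Ioo (-1 : ℝ) 1) (hst : s < t)
    (hx : x ∈ Set.Icc (-endpt q) (endpt q)) (y : ℝ) :
    transDens q s t x y = rat q (t - s) x y * dens q y := by
  by_cases hy : y ∈ Set.Ioo (-endpt q) (endpt q)
  · have hy' := Set.Ioo_subset_Icc_self hy
    rw [transDens, qPoch_mul_tprod_eq_ratio hq (sub_pos.2 hst) hx hy', rat, clamp_of_mem hx,
      clamp_of_mem hy']
  · rw [transDens, dens_eq_zero hq hy, mul_zero, mul_zero]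

lemma abs_transDens_div_dens_sub_one_le {t : ℝ} (hq : q ∈ Set.Ioo (-1 : ℝ) 1) (ht : 1 ≤ t)
    (hx : x ∈ Set.Ioo (-endpt q) (endpt q)) (hy : y ∈ Set.Ioo (-endpt q) (endpt q)) :
    |transDens q 0 t x y / dens q y - 1| ≤ mixConst q * Real.exp (-t) := by
  have hx' := Set.Ioo_subset_Icc_self hx
  rw [transDens_eq hq (by linarith) hx', mul_div_cancel_right₀ _ (dens_pos hq hy).ne', rat,
    sub_zero]
  exact abs_ratio_sub_one_le hq ht (clamp_mem hq x) (clamp_mem hq y)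

/-- Points on different sides of the middle half of the domain stay far apart. -/
lemma endpt_le_abs_clamp_sub {b : ℝ} (hb : endpt q / 2 ≤ b) (hb' : b < endpt q)
    (hx : x < -b) (hy : b < y) : endpt q ≤ |clamp q x - clamp q y| := by
  have h1 : clamp q x ≤ -b := max_le (by linarith) ((min_le_left _ _).trans hx.le)
  have h2 : b ≤ clamp q y := le_max_of_le_right (le_min hy.le hb'.le)
  rw [abs_sub_comm]
  exact le_trans (by linarith) (le_abs_self _)

end Rat

/-! ### Stationary Markov processes given by a symmetric density ratio -/

section Markov

variable {Ω : Type*}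

/-- The σ-algebra of the process up to time `s`. -/
abbrev past (X : ℝ≥0 → Ω → ℝ) (s : ℝ≥0) : MeasurableSpace Ω :=
  ⨆ u ∈ Set.Iic s, MeasurableSpace.comap (X u) inferInstance

/-- The σ-algebra of the process from time `s` on. -/
abbrev fut (X : ℝ≥0 → Ω → ℝ) (s : ℝ≥0) : MeasurableSpace Ω :=
  ⨆ u ∈ Set.Ici s, MeasurableSpace.comap (X u) inferInstance

variable {X : ℝ≥0 → Ω → ℝ} {s t u : ℝ≥0}

lemma past_mono (h : s ≤ t) : past X s ≤ past X t :=
  biSup_mono fun _ hu => le_trans hu h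

lemma fut_anti (h : s ≤ t) : fut X t ≤ fut X s :=
  biSup_mono fun _ hu => le_trans h hu

lemma measurable_past (h : u ≤ s) : Measurable[past X s] (X u) :=
  measurable_iff_comap_le.2 (le_biSup (fun u => MeasurableSpace.comap (X u) inferInstance) h)

lemma measurable_fut (h : s ≤ u) : Measurable[fut X s] (X u) :=
  measurable_iff_comap_le.2 (le_biSup (fun u => MeasurableSpace.comap (X u) inferInstance) h)

/-- `X` is stationary with marginal `π` and Markov, `r δ` being the density of the law of
`(X s, X (s + δ))` with respect to `π × π`. -/
structure IsStationaryMarkov [MeasurableSpace Ω] (X : ℝ≥0 → Ω → ℝ) (μ : Measure Ω)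
    (π : Measure ℝ) (r : ℝ≥0 → ℝ → ℝ → ℝ≥0∞) : Prop where
  measurable : ∀ t, Measurable (X t)
  map_eq : ∀ t, μ.map (X t) = π
  measurable_ratio : ∀ δ, 0 < δ → Measurable fun z : ℝ × ℝ => r δ z.1 z.2
  symm : ∀ δ x y, r δ x y = r δ y x
  markov : ∀ s t, s < t → ∀ A, MeasurableSet A → ∀ G, MeasurableSet[past X s] G →
    μ (G ∩ X t ⁻¹' A) = ∫⁻ ω in G, ∫⁻ y in A, r (t - s) (X s ω) y ∂π ∂μ

namespace IsStationaryMarkov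

variable [MeasurableSpace Ω] {μ : Measure Ω} [IsProbabilityMeasure μ] {π : Measure ℝ}
  [IsProbabilityMeasure π] {r : ℝ≥0 → ℝ → ℝ → ℝ≥0∞}

lemma past_le (h : IsStationaryMarkov X μ π r) (s : ℝ≥0) : past X s ≤ ‹MeasurableSpace Ω› :=
  iSup₂_le fun u _ => (h.measurable u).comap_le

lemma fut_le (h : IsStationaryMarkov X μ π r) (s : ℝ≥0) : fut X s ≤ ‹MeasurableSpace Ω› :=
  iSup₂_le fun u _ => (h.measurable u).comap_le

lemma measure_preimage (h : IsStationaryMarkov X μ π r) (t : ℝ≥0) {A : Set ℝ}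
    (hA : MeasurableSet A) : μ (X t ⁻¹' A) = π A := by
  rw [← h.map_eq t, Measure.map_apply (h.measurable t) hA]

lemma setLIntegral_comp (h : IsStationaryMarkov X μ π r) (t : ℝ≥0) {A : Set ℝ}
    (hA : MeasurableSet A) {g : ℝ → ℝ≥0∞} (hg : Measurable g) :
    ∫⁻ ω in X t ⁻¹' A, g (X t ω) ∂μ = ∫⁻ y in A, g y ∂π := by
  rw [← h.map_eq t, setLIntegral_map hA hg (h.measurable t)]

lemma measurable_kernel (h : IsStationaryMarkov X μ π r) {δ : ℝ≥0} (hδ : 0 < δ) (A : Set ℝ) :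
    Measurable fun x => ∫⁻ y in A, r δ x y ∂π :=
  (h.measurable_ratio δ hδ).lintegral_prod_right'

/-- The Markov property for events says that two measures agree on the past σ-algebra; integrating
`w` against both extends it from events to weights. -/
lemma lintegral_markov (h : IsStationaryMarkov X μ π r) (hst : s < t) {A : Set ℝ}
    (hA : MeasurableSet A) {w : Ω → ℝ≥0∞} (hw : Measurable[past X s] w) :
    ∫⁻ ω in X t ⁻¹' A, w ω ∂μ =
      ∫⁻ ω, w ω * ∫⁻ y in A, r (t - s) (X s ω) y ∂π ∂μ := by
  have hk : Measurable fun ω => ∫⁻ y in A, r (t - s) (X s ω) y ∂π :=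
    (h.measurable_kernel (tsub_pos_of_lt hst) A).comp (h.measurable s)
  have hle := h.past_le s
  have key : (μ.restrict (X t ⁻¹' A)).trim hle =
      (μ.withDensity fun ω => ∫⁻ y in A, r (t - s) (X s ω) y ∂π).trim hle := by
    refine @Measure.ext _ (past X s) _ _ fun G hG => ?_
    rw [trim_measurableSet_eq hle hG, trim_measurableSet_eq hle hG,
      Measure.restrict_apply (hle _ hG), withDensity_apply _ (hle _ hG),
      h.markov s t hst A hA G hG]
  calc ∫⁻ ω in X t ⁻¹' A, w ω ∂μ = ∫⁻ ω, w ω ∂((μ.restrict (X t ⁻¹' A)).trim hle) :=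
        (lintegral_trim hle hw).symm
    _ = ∫⁻ ω, w ω ∂(μ.withDensity fun ω => ∫⁻ y in A, r (t - s) (X s ω) y ∂π) := by
        rw [key, lintegral_trim hle hw]
    _ = _ := by
        rw [lintegral_withDensity_eq_lintegral_mul _ hk (hw.mono hle le_rfl)]
        exact lintegral_congr fun ω => mul_comm _ _

/-- Two past weights with the same image at time `s` give the same integral of a function
of `X s`. -/
lemma lintegral_mul_comp_congr (h : IsStationaryMarkov X μ π r) {w w' : Ω → ℝ≥0∞}
    (hw : Measurable w) (hw' : Measurable w')
    (heq : ∀ A, MeasurableSet A → ∫⁻ ω in X s ⁻¹' A, w ω ∂μ = ∫⁻ ω in X s ⁻¹' A, w' ω ∂μ)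
    {g : ℝ → ℝ≥0∞} (hg : Measurable g) :
    ∫⁻ ω, w ω * g (X s ω) ∂μ = ∫⁻ ω, w' ω * g (X s ω) ∂μ := by
  have key : (μ.withDensity w).map (X s) = (μ.withDensity w').map (X s) := by
    ext A hA
    rw [Measure.map_apply (h.measurable s) hA, Measure.map_apply (h.measurable s) hA,
      withDensity_apply _ (h.measurable s hA), withDensity_apply _ (h.measurable s hA), heq A hA]
  have e : ∀ v : Ω → ℝ≥0∞, Measurable v →
      ∫⁻ ω, v ω * g (X s ω) ∂μ = ∫⁻ x, g x ∂((μ.withDensity v).map (X s)) := fun v hv => by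
    rw [lintegral_map hg (h.measurable s),
      lintegral_withDensity_eq_lintegral_mul₀ hv.aemeasurable
        (f := v) (g := fun ω => g (X s ω)) (hg.comp (h.measurable s)).aemeasurable]
    rfl
  rw [e w hw, e w' hw', key]

/-- Induction over the times in increasing order. The earliest constraint X_a ∈ A_a is absorbed into
both weights as an indicator, and the Markov property shows that the new weights again have equal
images at time a. -/
lemma setLIntegral_cylinder_congr (h : IsStationaryMarkov X μ π r) (F : Finset ℝ≥0) :
    ∀ s, (∀ u ∈ F, s ≤ u) → ∀ A : ℝ≥0 → Set ℝ, (∀ u ∈ F, MeasurableSet (A u)) →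
    ∀ w w' : Ω → ℝ≥0∞, Measurable[past X s] w → Measurable[past X s] w' →
    (∀ A, MeasurableSet A → ∫⁻ ω in X s ⁻¹' A, w ω ∂μ = ∫⁻ ω in X s ⁻¹' A, w' ω ∂μ) →
    ∫⁻ ω in ⋂ u ∈ F, X u ⁻¹' A u, w ω ∂μ = ∫⁻ ω in ⋂ u ∈ F, X u ⁻¹' A u, w' ω ∂μ := by
  induction F using Finset.induction_on_min with
  | empty =>
    intro s _ A _ w w' _ _ heq
    simpa using heq Set.univ MeasurableSet.univ
  | insert a F ha ih =>
    intro s hs A hA w w' hw hw' heq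
    have hAa : MeasurableSet (A a) := hA a (Finset.mem_insert_self a F)
    have hsa : s ≤ a := hs a (Finset.mem_insert_self a F)
    have hP : MeasurableSet[past X a] (X a ⁻¹' A a) := measurable_past le_rfl hAa
    have hP' : MeasurableSet (X a ⁻¹' A a) := h.measurable a hAa
    have e : ∀ (v : Ω → ℝ≥0∞) (Q : Set Ω),
        ∫⁻ ω in Q, (X a ⁻¹' A a).indicator v ω ∂μ = ∫⁻ ω in X a ⁻¹' A a ∩ Q, v ω ∂μ :=
      fun v Q => by rw [setLIntegral_indicator hP']
    rw [Finset.set_biInter_insert, ← e w, ← e w']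
    refine ih a (fun u hu => (ha u hu).le) A (fun u hu => hA u (Finset.mem_insert_of_mem hu)) _ _
      ((hw.mono (past_mono hsa) le_rfl).indicator hP)
      ((hw'.mono (past_mono hsa) le_rfl).indicator hP) fun B hB => ?_
    rw [e, e, ← Set.preimage_inter]
    rcases hsa.eq_or_lt with rfl | hlt
    · exact heq _ (hAa.inter hB)
    · rw [h.lintegral_markov hlt (hAa.inter hB) hw, h.lintegral_markov hlt (hAa.inter hB) hw']
      exact h.lintegral_mul_comp_congr (hw.mono (h.past_le s) le_rfl)
        (hw'.mono (h.past_le s) le_rfl) heq (h.measurable_kernel (tsub_pos_of_lt hlt) _)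

/-- The Markov property: the integral of a past weight over a future event depends only on the
image of the weight at the present. -/
lemma setLIntegral_fut_congr (h : IsStationaryMarkov X μ π r) {w w' : Ω → ℝ≥0∞}
    (hw : Measurable[past X s] w) (hw' : Measurable[past X s] w') (hfin : ∫⁻ ω, w ω ∂μ ≠ ∞)
    (heq : ∀ A, MeasurableSet A → ∫⁻ ω in X s ⁻¹' A, w ω ∂μ = ∫⁻ ω in X s ⁻¹' A, w' ω ∂μ)
    {H : Set Ω} (hH : MeasurableSet[fut X s] H) :
    ∫⁻ ω in H, w ω ∂μ = ∫⁻ ω in H, w' ω ∂μ := by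
  have hle := h.fut_le s
  have : IsFiniteMeasure (μ.withDensity w) := isFiniteMeasure_withDensity hfin
  have key : (μ.withDensity w).trim hle = (μ.withDensity w').trim hle := by
    have hfin' : IsFiniteMeasure ((μ.withDensity w).trim hle) := isFiniteMeasure_trim hle
    refine @ext_of_generate_finite _ (fut X s) _ _ _
      (generateFrom_piiUnionInter_measurableSet
        (fun u => MeasurableSpace.comap (X u) inferInstance) (Set.Ici s)).symm
      (isPiSystem_piiUnionInter _ (fun u => @MeasurableSpace.isPiSystem_measurableSet Ω
        (MeasurableSpace.comap (X u) inferInstance)) _)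
      hfin' ?_ ?_
    · rintro Q ⟨F, hF, f, hf, rfl⟩
      choose! A hA hfA using hf
      have e : (⋂ u ∈ F, f u) = ⋂ u ∈ F, X u ⁻¹' A u :=
        Set.iInter₂_congr fun u hu => (hfA u hu).symm
      have hmeas : MeasurableSet[fut X s] (⋂ u ∈ F, X u ⁻¹' A u) :=
        Finset.measurableSet_biInter _ fun u hu => measurable_fut (hF hu) (hA u hu)
      rw [e, trim_measurableSet_eq hle hmeas, trim_measurableSet_eq hle hmeas,
        withDensity_apply _ (hle _ hmeas), withDensity_apply _ (hle _ hmeas)]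
      exact h.setLIntegral_cylinder_congr F s (fun u hu => hF hu) A hA w w' hw hw' heq
    · rw [trim_measurableSet_eq hle MeasurableSet.univ, trim_measurableSet_eq hle MeasurableSet.univ,
        withDensity_apply _ MeasurableSet.univ, withDensity_apply _ MeasurableSet.univ]
      simpa using heq Set.univ MeasurableSet.univ
  have h1 := congrArg (fun ν => ν H) key
  rwa [trim_measurableSet_eq hle hH, trim_measurableSet_eq hle hH,
    withDensity_apply _ (hle _ hH), withDensity_apply _ (hle _ hH)] at h1

/-- If the past event `G` has density `g` at the present, then future events are weighted
by `g`. -/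
lemma measure_inter_eq_of_density (h : IsStationaryMarkov X μ π r) {G H : Set Ω}
    (hG : MeasurableSet[past X s] G) (hH : MeasurableSet[fut X s] H) {g : ℝ → ℝ≥0∞}
    (hg : Measurable g)
    (heq : ∀ A, MeasurableSet A → μ (G ∩ X s ⁻¹' A) = ∫⁻ y in A, g y ∂π) :
    μ (G ∩ H) = ∫⁻ ω in H, g (X s ω) ∂μ := by
  have hG' := h.past_le s _ hG
  have e : ∀ Q : Set Ω, ∫⁻ ω in Q, G.indicator 1 ω ∂μ = μ (G ∩ Q) := fun Q => by
    rw [lintegral_indicator_one hG', Measure.restrict_apply hG']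
  rw [← e]
  refine h.setLIntegral_fut_congr (w := G.indicator 1) (w' := fun ω => g (X s ω))
    (Measurable.indicator (@measurable_const _ _ _ (past X s) 1) hG)
    (hg.comp (measurable_past le_rfl)) ?_ (fun A hA => ?_) hH
  · rw [lintegral_indicator_one hG']
    exact measure_ne_top _ _
  · rw [e, heq A hA, h.setLIntegral_comp s hA hg]

lemma measurable_past_density (h : IsStationaryMarkov X μ π r) (hst : s < t) (G : Set Ω) :
    Measurable fun y => ∫⁻ ω in G, r (t - s) (X s ω) y ∂μ := by
  have h1 : Measurable fun z : ℝ × Ω => r (t - s) (X s z.2) z.1 :=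
    (h.measurable_ratio _ (tsub_pos_of_lt hst)).comp
      (((h.measurable s).comp measurable_snd).prodMk measurable_fst)
  exact h1.lintegral_prod_right'

/-- Fubini turns the Markov property into a density: on `G`, the law of X_t has density y ↦ ∫_G r(t
− s, X_s, y) with respect to π. -/
lemma measure_inter_preimage (h : IsStationaryMarkov X μ π r) (hst : s < t) {G : Set Ω}
    (hG : MeasurableSet[past X s] G) {A : Set ℝ} (hA : MeasurableSet A) :
    μ (G ∩ X t ⁻¹' A) = ∫⁻ y in A, ∫⁻ ω in G, r (t - s) (X s ω) y ∂μ ∂π := by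
  rw [h.markov s t hst A hA G hG, lintegral_lintegral_swap]
  refine Measurable.aemeasurable ?_
  exact (h.measurable_ratio _ (tsub_pos_of_lt hst)).comp
    (((h.measurable s).comp measurable_fst).prodMk measurable_snd)

/-- The joint probability of a past and a future event through the density ratio. -/
lemma measure_inter_eq (h : IsStationaryMarkov X μ π r) (hst : s < t) {G H : Set Ω}
    (hG : MeasurableSet[past X s] G) (hH : MeasurableSet[fut X t] H) :
    μ (G ∩ H) = ∫⁻ ω in H, ∫⁻ ω' in G, r (t - s) (X s ω') (X t ω) ∂μ ∂μ :=
  h.measure_inter_eq_of_density (past_mono hst.le _ hG) hH (h.measurable_past_density hst G)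
    fun _ hA => h.measure_inter_preimage hst hG hA

/-- The bound on the ratio is required only at states occupied on `G` and on `H`, so that the bounds
for separated points apply to jump events. -/
lemma measure_inter_le (h : IsStationaryMarkov X μ π r) (hst : s < t) {G H : Set Ω}
    (hG : MeasurableSet[past X s] G) (hH : MeasurableSet[fut X t] H) {C : ℝ≥0∞}
    (hC : ∀ ω' ∈ G, ∀ ω ∈ H, r (t - s) (X s ω') (X t ω) ≤ C) :
    μ (G ∩ H) ≤ C * μ G * μ H := by
  have hG' := h.past_le s _ hG
  have hH' := h.fut_le t _ hH
  rw [h.measure_inter_eq hst hG hH]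
  calc _ ≤ ∫⁻ _ in H, ∫⁻ _ in G, C ∂μ ∂μ :=
        setLIntegral_mono' hH' fun ω hω => setLIntegral_mono' hG' fun ω' hω' => hC ω' hω' ω hω
    _ = _ := by simp

lemma le_measure_inter (h : IsStationaryMarkov X μ π r) (hst : s < t) {G H : Set Ω}
    (hG : MeasurableSet[past X s] G) (hH : MeasurableSet[fut X t] H) {c : ℝ≥0∞}
    (hc : ∀ ω' ∈ G, ∀ ω ∈ H, c ≤ r (t - s) (X s ω') (X t ω)) :
    c * μ G * μ H ≤ μ (G ∩ H) := by
  have hG' := h.past_le s _ hG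
  have hH' := h.fut_le t _ hH
  rw [h.measure_inter_eq hst hG hH]
  calc _ = ∫⁻ _ in H, ∫⁻ _ in G, c ∂μ ∂μ := by simp
    _ ≤ _ :=
        setLIntegral_mono' hH' fun ω hω => setLIntegral_mono' hG' fun ω' hω' => hc ω' hω' ω hω

end IsStationaryMarkov

end Markov

/-! ### The `q`-Ornstein--Uhlenbeck process as a stationary Markov process -/

/-- The marginal law. -/
def law (q : ℝ) : Measure ℝ := volume.withDensity fun x => ENNReal.ofReal (dens q x)

/-- The extended density ratio with values in `[0, ∞]`. -/
def eratio (q : ℝ) (δ : ℝ≥0) (x y : ℝ) : ℝ≥0∞ := ENNReal.ofReal (rat q δ x y)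

section QOUMarkov

variable {q : ℝ} {Ω : Type*} [MeasurableSpace Ω] {X : ℝ≥0 → Ω → ℝ} {μ : Measure Ω}

lemma law_Ioo_compl (hq : q ∈ Set.Ioo (-1 : ℝ) 1) :
    law q (Set.Ioo (-endpt q) (endpt q))ᶜ = 0 := by
  rw [law, withDensity_apply _ measurableSet_Ioo.compl]
  refine (setLIntegral_congr_fun measurableSet_Ioo.compl fun x hx => ?_).trans lintegral_zero
  simp [dens_eq_zero hq hx]

lemma IsQOUProcess.isProbabilityMeasure_law [IsProbabilityMeasure μ]
    (h : IsQOUProcess q X μ) : IsProbabilityMeasure (law q) := by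
  rw [law, ← h.marginal 0]
  exact Measure.isProbabilityMeasure_map (h.measurable 0).aemeasurable

lemma measurable_eratio (hq : q ∈ Set.Ioo (-1 : ℝ) 1) {δ : ℝ≥0} (hδ : 0 < δ) :
    Measurable fun z : ℝ × ℝ => eratio q δ z.1 z.2 :=
  (measurable_rat hq (by exact_mod_cast hδ)).ennreal_ofReal

lemma measurable_eratio_right (hq : q ∈ Set.Ioo (-1 : ℝ) 1) {δ : ℝ≥0} (hδ : 0 < δ) (x : ℝ) :
    Measurable fun y => eratio q δ x y := by
  have h : Measurable fun y => rat q δ x y :=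
    (measurable_rat hq (by exact_mod_cast hδ)).comp (measurable_const.prodMk measurable_id)
  exact h.ennreal_ofReal

lemma setIntegral_transDens (hq : q ∈ Set.Ioo (-1 : ℝ) 1) {s t : ℝ≥0} (hst : s < t)
    {A : Set ℝ} (hA : MeasurableSet A) {x : ℝ} (hx : x ∈ Set.Icc (-endpt q) (endpt q)) :
    ∫ y in A, transDens q s t x y = (∫⁻ y in A, eratio q (t - s) x y ∂(law q)).toReal := by
  have hst' : (s : ℝ) < t := by exact_mod_cast hst
  have hm : Measurable fun y => rat q (t - s) x y :=
    (measurable_rat hq (sub_pos.2 hst')).comp (measurable_const.prodMk measurable_id)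
  have hr0 : ∀ y, 0 ≤ rat q (t - s) x y := fun y =>
    ratio_nonneg hq (sub_pos.2 hst').le (clamp_mem hq _) (clamp_mem hq _)
  have hfun : (fun y => transDens q s t x y) = fun y => rat q (t - s) x y * dens q y :=
    funext fun y => transDens_eq hq hst' hx y
  rw [hfun, integral_eq_lintegral_of_nonneg_ae
    (ae_of_all _ fun y => mul_nonneg (hr0 y) (dens_nonneg hq y))
    (hm.mul (measurable_dens hq)).aestronglyMeasurable]
  have hm' : Measurable fun y => eratio q (t - s) x y :=
    measurable_eratio_right hq (tsub_pos_of_lt hst) x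
  have e : ∫⁻ y in A, eratio q (t - s) x y ∂(law q) =
      ∫⁻ y in A, ENNReal.ofReal (dens q y) * eratio q (t - s) x y := by
    rw [law, setLIntegral_withDensity_eq_setLIntegral_mul volume
      (measurable_dens hq).ennreal_ofReal hm' hA]
    simp only [Pi.mul_apply]
  rw [e]
  congr 1
  refine lintegral_congr fun y => ?_
  rw [eratio, NNReal.coe_sub hst.le, mul_comm, ENNReal.ofReal_mul (dens_nonneg hq y)]

lemma IsQOUProcess.ae_mem [IsProbabilityMeasure μ] (hq : q ∈ Set.Ioo (-1 : ℝ) 1)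
    (h : IsQOUProcess q X μ) (t : ℝ≥0) :
    ∀ᵐ ω ∂μ, X t ω ∈ Set.Icc (-endpt q) (endpt q) := by
  have h1 : μ.map (X t) (Set.Ioo (-endpt q) (endpt q))ᶜ = 0 := by
    rw [h.marginal t]; exact law_Ioo_compl hq
  rw [Measure.map_apply (h.measurable t) measurableSet_Ioo.compl] at h1
  exact (show ∀ᵐ ω ∂μ, X t ω ∈ Set.Ioo (-endpt q) (endpt q) from h1).mono
    fun ω hω => Set.Ioo_subset_Icc_self hω

/-- The conditional expectation is integrated over a past event and rewritten with nonnegative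
integrals. X_s lies in the domain almost surely, and the ratio is bounded at a fixed positive time
lag, so no infinite value is lost under `toReal`. -/
lemma IsQOUProcess.isStationaryMarkov [IsProbabilityMeasure μ] (hq : q ∈ Set.Ioo (-1 : ℝ) 1)
    (h : IsQOUProcess q X μ) : IsStationaryMarkov X μ (law q) (eratio q) where
  measurable := h.measurable
  map_eq := h.marginal
  measurable_ratio δ hδ := measurable_eratio hq hδ
  symm δ x y := by rw [eratio, eratio, rat, rat, ratio_symm]
  markov s t hst A hA G hG := by
    have hπ := h.isProbabilityMeasure_law
    have hle : past X s ≤ ‹MeasurableSpace Ω› := iSup₂_le fun u _ => (h.measurable u).comap_le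
    have hst' : (0 : ℝ) < (t - s : ℝ≥0) := by exact_mod_cast tsub_pos_of_lt hst
    have hmeasA := h.measurable t hA
    obtain ⟨C, hC⟩ := ratio_le_of_pos hq hst'
    have hKle : ∀ x, ∫⁻ y in A, eratio q (t - s) x y ∂(law q) ≤ ENNReal.ofReal C := fun x => by
      calc _ ≤ ∫⁻ _ in A, ENNReal.ofReal C ∂(law q) := lintegral_mono fun y =>
            ENNReal.ofReal_le_ofReal (hC _ (clamp_mem hq _) _ (clamp_mem hq _))
        _ ≤ ENNReal.ofReal C := by
            rw [setLIntegral_const]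
            exact mul_le_of_le_one_right' prob_le_one
    have hK : Measurable fun ω => ∫⁻ y in A, eratio q (t - s) (X s ω) y ∂(law q) :=
      ((measurable_eratio hq (tsub_pos_of_lt hst)).lintegral_prod_right').comp (h.measurable s)
    have h1 : ∫ ω in G, (∫⁻ y in A, eratio q (t - s) (X s ω) y ∂(law q)).toReal ∂μ =
        μ.real (G ∩ X t ⁻¹' A) := by
      calc _ = ∫ ω in G, (μ[(X t ⁻¹' A).indicator (fun _ => (1 : ℝ)) | past X s]) ω ∂μ := by
            refine integral_congr_ae (ae_restrict_of_ae ?_)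
            filter_upwards [h.markov s t hst A hA, h.ae_mem hq s] with ω hω hmem
            rw [hω, setIntegral_transDens hq hst hA hmem]
        _ = ∫ ω in G, (X t ⁻¹' A).indicator (fun _ => (1 : ℝ)) ω ∂μ :=
            setIntegral_condExp hle ((integrable_const _).indicator hmeasA) hG
        _ = _ := by
            rw [integral_indicator hmeasA, setIntegral_const, smul_eq_mul, mul_one,
              measureReal_restrict_apply hmeasA, Set.inter_comm]
    rw [integral_toReal hK.aemeasurable (ae_of_all _ fun ω =>
      (hKle _).trans_lt ENNReal.ofReal_lt_top)] at h1
    refine ((ENNReal.toReal_eq_toReal_iff' ?_ (measure_ne_top _ _)).1 h1).symm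
    refine ne_top_of_le_ne_top (ENNReal.ofReal_ne_top (r := C)) ?_
    calc _ ≤ ∫⁻ _ in G, ENNReal.ofReal C ∂μ := lintegral_mono fun ω => hKle _
      _ ≤ ENNReal.ofReal C := by
          rw [setLIntegral_const]
          exact mul_le_of_le_one_right' prob_le_one

end QOUMarkov

/-! ### Jumps of càdlàg paths along dyadic grids -/

/-- The path `f` jumps from below `-b` to above `b` at some time in `(u, v]`. -/
def HasJump (f : ℝ≥0 → ℝ) (b : ℝ) (u v : ℝ≥0) : Prop :=
  ∃ t ∈ Set.Ioc u v, Function.leftLim f t < -b ∧ b < f t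

/-- The `k`-th point of the partition of `[u, u + h]` into `2 ^ n` intervals. -/
def grid (u h : ℝ≥0) (n k : ℕ) : ℝ≥0 := u + h * k / 2 ^ n

/-- Some step of the `n`-th partition of `[u, u + h]` goes from below `-b` to above `b`. -/
def HasGridJump (f : ℝ≥0 → ℝ) (b : ℝ) (u h : ℝ≥0) (n : ℕ) : Prop :=
  ∃ k < 2 ^ n, f (grid u h n k) < -b ∧ b < f (grid u h n (k + 1))

section Paths

variable {f : ℝ≥0 → ℝ} {b b' : ℝ} {u v h t : ℝ≥0}

lemma HasJump.mono_level (hb : b ≤ b') (hf : HasJump f b' u v) : HasJump f b u v := by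
  obtain ⟨t, ht, h1, h2⟩ := hf
  exact ⟨t, ht, by linarith, by linarith⟩

lemma hasJump_union {w : ℝ≥0} (huv : u ≤ v) (hvw : v ≤ w) :
    HasJump f b u w ↔ HasJump f b u v ∨ HasJump f b v w := by
  simp only [HasJump, ← Set.Ioc_union_Ioc_eq_Ioc huv hvw, Set.mem_union]
  constructor
  · rintro ⟨t, ht | ht, h⟩
    exacts [Or.inl ⟨t, ht, h⟩, Or.inr ⟨t, ht, h⟩]
  · rintro (⟨t, ht, h⟩ | ⟨t, ht, h⟩)
    exacts [⟨t, Or.inl ht, h⟩, ⟨t, Or.inr ht, h⟩]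

lemma coe_grid (u h : ℝ≥0) (n k : ℕ) : (grid u h n k : ℝ) = u + h * k / 2 ^ n := by
  simp [grid]

lemma le_grid (u h : ℝ≥0) (n k : ℕ) : u ≤ grid u h n k := le_self_add

lemma grid_le {n k : ℕ} (hk : k ≤ 2 ^ n) : grid u h n k ≤ u + h := by
  unfold grid
  gcongr
  rw [mul_div_assoc]
  refine mul_le_of_le_one_right' (div_le_one_of_le₀ ?_ zero_le)
  exact_mod_cast hk

lemma grid_mono {n j k : ℕ} (hjk : j ≤ k) : grid u h n j ≤ grid u h n k := by
  unfold grid; gcongr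

lemma grid_succ (u h : ℝ≥0) (n k : ℕ) : grid u h n (k + 1) = grid u h n k + h / 2 ^ n := by
  unfold grid; push_cast; ring

lemma grid_lt_succ (hh : 0 < h) (n k : ℕ) : grid u h n k < grid u h n (k + 1) := by
  rw [grid_succ]
  exact lt_add_of_pos_right _ (by positivity)

lemma tendsto_mesh (h : ℝ≥0) : Tendsto (fun n : ℕ => (h : ℝ) / 2 ^ n) atTop (𝓝 0) := by
  have := (tendsto_pow_atTop_nhds_zero_of_lt_one (r := (1 / 2 : ℝ)) (by norm_num)
    (by norm_num)).const_mul (h : ℝ)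
  simpa [div_eq_mul_inv] using this

lemma tendsto_leftLim (hf : IsCadlag f) (ht : 0 < t) :
    Tendsto f (𝓝[<] t) (𝓝 (Function.leftLim f t)) := by
  obtain ⟨l, hl⟩ := (hf t).2
  have : (𝓝[<] t).NeBot := nhdsLT_neBot_of_exists_lt ⟨0, ht⟩
  rwa [leftLim_eq_of_tendsto hl]

/-- A jump is seen by all fine partitions. -/
lemma HasJump.eventually_hasGridJump (hf : IsCadlag f) (hh : 0 < h)
    (hj : HasJump f b u (u + h)) : ∀ᶠ n in atTop, HasGridJump f b u h n := by
  obtain ⟨t, ⟨hut, htv⟩, h1, h2⟩ := hj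
  have ht0 : 0 < t := hut.pos
  have hl : ∀ᶠ x in 𝓝[<] t, f x < -b := (tendsto_leftLim hf ht0).eventually_lt_const h1
  obtain ⟨t0, ht0t, hl'⟩ := (mem_nhdsLT_iff_exists_Ioo_subset' (show (0 : ℝ≥0) < t from ht0)).1 hl
  have hr : ∀ᶠ x in 𝓝[≥] t, b < f x := (hf t).1.eventually_const_lt h2
  obtain ⟨t1, ht1t, hr'⟩ := mem_nhdsGE_iff_exists_Ico_subset.1 hr
  have e1 : (0 : ℝ) < t - t0 := sub_pos.2 (by exact_mod_cast ht0t)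
  have e2 : (0 : ℝ) < t1 - t := sub_pos.2 (by exact_mod_cast ht1t)
  filter_upwards [(tendsto_mesh h).eventually_lt_const e1,
    (tendsto_mesh h).eventually_lt_const e2] with n hn1 hn2
  have hpow : (0 : ℝ) < 2 ^ n := by positivity
  have hhR : (0 : ℝ) < h := by exact_mod_cast hh
  have hutR : (u : ℝ) < t := by exact_mod_cast hut
  have htvR : (t : ℝ) ≤ u + h := by exact_mod_cast htv
  set z : ℝ := ((t : ℝ) - u) * 2 ^ n / h with hz
  have hz0 : 0 < z := by
    have : 0 < (t : ℝ) - u := sub_pos.2 hutR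
    positivity
  have hz1 : z ≤ 2 ^ n := by
    rw [hz, div_le_iff₀ hhR]
    nlinarith
  have hc0 : 0 < ⌈z⌉₊ := Nat.ceil_pos.2 hz0
  -- Rounding up selects the cell whose left end is strictly before t, where the left limit governs,
  -- and whose right end is at or after t, where right continuity does.
  obtain ⟨k, hk⟩ : ∃ k, ⌈z⌉₊ = k + 1 := ⟨⌈z⌉₊ - 1, by omega⟩
  have hkz : (k : ℝ) < z := by
    have := Nat.lt_ceil.1 (show k < ⌈z⌉₊ by omega)
    exact this
  have hzk : z ≤ k + 1 := by
    have := Nat.le_ceil z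
    rw [hk] at this
    exact_mod_cast this
  have hk2 : k < 2 ^ n := by
    have : (k : ℝ) < 2 ^ n := hkz.trans_le hz1
    exact_mod_cast this
  have et : (t : ℝ) = u + h * z / 2 ^ n := by
    rw [hz]; field_simp; ring
  have g1 : (grid u h n k : ℝ) < t := by
    rw [coe_grid, et]
    gcongr
  have g2 : (t : ℝ) ≤ grid u h n (k + 1) := by
    rw [coe_grid, et]
    push_cast
    gcongr
  have g3 : (grid u h n (k + 1) : ℝ) = grid u h n k + h / 2 ^ n := by
    rw [grid_succ]; push_cast; ring
  refine ⟨k, hk2, hl' ⟨?_, ?_⟩, hr' ⟨?_, ?_⟩⟩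
  · exact_mod_cast (by linarith : (t0 : ℝ) < grid u h n k)
  · exact_mod_cast g1
  · exact_mod_cast g2
  · exact_mod_cast (by linarith : (grid u h n (k + 1) : ℝ) < t1)

/-- On such an interval b' ≤ f ≤ −b', which forces b' ≤ 0; every interior point then counts as a
jump at the lower level b. This degenerate case occurs because b = a_q − ε is nonpositive for ε ≥
a_q. -/
lemma hasJump_of_interval (hf : IsCadlag f) {p r : ℝ≥0} (hp : u ≤ p) (hr : r ≤ v) (hpr : p < r)
    (hb : b < b') (hI : ∀ x ∈ Set.Ioo p r, f x ≤ -b' ∧ b' ≤ f x) : HasJump f b u v := by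
  obtain ⟨t, hpt, htr⟩ := exists_between hpr
  have ht0 : 0 < t := hpt.pos
  refine ⟨t, ⟨hp.trans_lt hpt, htr.le.trans hr⟩, ?_, ?_⟩
  · have : (𝓝[<] t).NeBot := nhdsLT_neBot_of_exists_lt ⟨0, ht0⟩
    have hle : Function.leftLim f t ≤ -b' := by
      refine le_of_tendsto (tendsto_leftLim hf ht0) ?_
      filter_upwards [Ioo_mem_nhdsLT hpt] with x hx
      exact (hI x ⟨hx.1, hx.2.trans htr⟩).1
    linarith
  · linarith [(hI t ⟨hpt, htr⟩).2]

/-- Jumps seen by infinitely many partitions come from a jump of the path. -/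
lemma hasJump_of_frequently (hf : IsCadlag f) (hh : 0 < h) (hb : b < b')
    (hj : ∃ᶠ n in atTop, HasGridJump f b' u h n) : HasJump f b u (u + h) := by
  have hne : (atTop ⊓ 𝓟 {n | HasGridJump f b' u h n}).NeBot := frequently_iff_neBot.1 hj
  -- Along an ultrafilter both ends of the jumping cells converge to one point t, and each end stays
  -- on a definite side of t.
  obtain ⟨U, hU⟩ := Ultrafilter.exists_le (atTop ⊓ 𝓟 {n | HasGridJump f b' u h n})
  have hUtop : (U : Filter ℕ) ≤ atTop := hU.trans inf_le_left
  have hUj : ∀ᶠ n in (U : Filter ℕ), HasGridJump f b' u h n :=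
    le_principal_iff.1 (hU.trans inf_le_right)
  choose! k hk hk1 hk2 using fun n (hn : HasGridJump f b' u h n) => hn
  set s : ℕ → ℝ≥0 := fun n => grid u h n (k n) with hs
  set e : ℕ → ℝ≥0 := fun n => grid u h n (k n + 1) with he
  have hse : ∀ n, s n < e n := fun n => grid_lt_succ hh n (k n)
  have hle : ∀ᶠ n in (U : Filter ℕ), e n ≤ u + h := hUj.mono fun n hn => grid_le (hk n hn)
  have hus : ∀ n, u ≤ s n := fun n => le_grid _ _ _ _
  have hcpt : ∀ᶠ n in (U : Filter ℕ), s n ∈ Set.Icc u (u + h) :=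
    hle.mono fun n hn => ⟨hus n, (hse n).le.trans hn⟩
  obtain ⟨t, ht, hlim⟩ := (isCompact_Icc (a := u) (b := u + h)).ultrafilter_le_nhds (U.map s)
    (le_principal_iff.2 hcpt)
  have hst : Tendsto s U (𝓝 t) := hlim
  have het : Tendsto e U (𝓝 t) := by
    have h1 : Tendsto (fun n => s n + h / 2 ^ n) U (𝓝 (t + 0)) := by
      refine hst.add ?_
      have : Tendsto (fun n : ℕ => h / 2 ^ n) atTop (𝓝 0) := by
        rw [← NNReal.tendsto_coe]
        simpa using tendsto_mesh h
      exact this.mono_left hUtop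
    simpa [hs, he, grid_succ] using h1
  have hfs : ∀ᶠ n in (U : Filter ℕ), f (s n) ≤ -b' := hUj.mono fun n hn => (hk1 n hn).le
  have hfe : ∀ᶠ n in (U : Filter ℕ), b' ≤ f (e n) := hUj.mono fun n hn => (hk2 n hn).le
  set c := (b + b') / 2 with hc
  rcases U.em (fun n => s n < t) with hlt | hge
  · obtain ⟨n₀, hn₀⟩ := hlt.exists
    have hut : u < t := (hus n₀).trans_lt hn₀
    have ht0 : 0 < t := hut.pos
    have hL := tendsto_leftLim hf ht0
    have hfl : Tendsto (fun n => f (s n)) U (𝓝 (Function.leftLim f t)) :=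
      hL.comp (tendsto_nhdsWithin_iff.2 ⟨hst, hlt⟩)
    have hl1 : Function.leftLim f t ≤ -b' := le_of_tendsto hfl hfs
    -- If the cells straddle t, the jump is at t itself. If both ends lie to the left, the left
    -- limit is at most −b' and at least b', and `hasJump_of_interval` applies; likewise on the
    -- right.
    rcases U.em (fun n => e n < t) with hlt' | hge'
    · have hfl' : Tendsto (fun n => f (e n)) U (𝓝 (Function.leftLim f t)) :=
        hL.comp (tendsto_nhdsWithin_iff.2 ⟨het, hlt'⟩)
      have hl2 : b' ≤ Function.leftLim f t := ge_of_tendsto hfl' hfe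
      have hev : ∀ᶠ x in 𝓝[<] t, f x < -c ∧ c < f x :=
        (hL.eventually_lt_const (by linarith)).and (hL.eventually_const_lt (by linarith))
      obtain ⟨p, hp, hsub⟩ := (mem_nhdsLT_iff_exists_Ioo_subset' hut).1 hev
      refine hasJump_of_interval (p := max p u) (r := t) (b' := c) hf (le_max_right _ _) ht.2
        (max_lt hp hut) (by linarith) fun x hx => ?_
      have := hsub ⟨(le_max_left _ _).trans_lt hx.1, hx.2⟩
      exact ⟨this.1.le, this.2.le⟩
    · have hge'' : ∀ᶠ n in (U : Filter ℕ), e n ∈ Set.Ici t := hge'.mono fun n hn => not_lt.1 hn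
      have hfr : Tendsto (fun n => f (e n)) U (𝓝 (f t)) :=
        (hf t).1.tendsto.comp (tendsto_nhdsWithin_iff.2 ⟨het, hge''⟩)
      have hl2 : b' ≤ f t := ge_of_tendsto hfr hfe
      exact ⟨t, ⟨hut, ht.2⟩, by linarith, by linarith⟩
  · have hge1 : ∀ᶠ n in (U : Filter ℕ), s n ∈ Set.Ici t := hge.mono fun n hn => not_lt.1 hn
    have hge2 : ∀ᶠ n in (U : Filter ℕ), e n ∈ Set.Ici t :=
      hge1.mono fun n hn => le_trans hn (hse n).le
    obtain ⟨n₀, hn₀, hn₁⟩ := (hge1.and hle).exists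
    have htv : t < u + h := lt_of_le_of_lt hn₀ ((hse n₀).trans_le hn₁)
    have hl1 : f t ≤ -b' := le_of_tendsto
      ((hf t).1.tendsto.comp (tendsto_nhdsWithin_iff.2 ⟨hst, hge1⟩)) hfs
    have hl2 : b' ≤ f t := ge_of_tendsto
      ((hf t).1.tendsto.comp (tendsto_nhdsWithin_iff.2 ⟨het, hge2⟩)) hfe
    have hev : ∀ᶠ x in 𝓝[≥] t, f x < -c ∧ c < f x :=
      ((hf t).1.eventually_lt_const (by linarith)).and
        ((hf t).1.eventually_const_lt (by linarith))
    obtain ⟨r, hr, hsub⟩ := (mem_nhdsGE_iff_exists_Ico_subset' htv).1 hev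
    refine hasJump_of_interval (p := t) (r := min r (u + h)) (b' := c) hf ht.1 (min_le_right _ _)
      (lt_min hr htv) (by linarith) fun x hx => ?_
    have := hsub ⟨hx.1.le, hx.2.trans_le (min_le_left _ _)⟩
    exact ⟨this.1.le, this.2.le⟩

/-- The strict inequalities in a jump leave room to raise the level by 1/(m + 1), which pays for the
level lost in `hasJump_of_frequently`. The right-hand side involves countably many times only,
whence measurability. -/
lemma hasJump_iff (hf : IsCadlag f) (hh : 0 < h) :
    HasJump f b u (u + h) ↔
      ∃ m : ℕ, ∀ᶠ n in atTop, HasGridJump f (b + 1 / (m + 1)) u h n := by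
  constructor
  · rintro ⟨t, ht, h1, h2⟩
    obtain ⟨m, hm⟩ := exists_nat_one_div_lt
      (show 0 < min (-b - Function.leftLim f t) (f t - b) from lt_min (by linarith) (by linarith))
    refine ⟨m, HasJump.eventually_hasGridJump hf hh ⟨t, ht, ?_, ?_⟩⟩
    · linarith [hm.trans_le (min_le_left _ _)]
    · linarith [hm.trans_le (min_le_right _ _)]
  · rintro ⟨m, hm⟩
    exact hasJump_of_frequently hf hh (by linarith [Nat.one_div_pos_of_nat (α := ℝ) (n := m)])
      hm.frequently

/-- A path that is positive on the dyadic grids never jumps upwards across zero. -/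
lemma not_hasJump_of_pos (hf : IsCadlag f) (hh : 0 < h) (hb : 0 ≤ b)
    (hpos : ∀ n k, k ≤ 2 ^ n → 0 < f (grid u h n k)) : ¬ HasJump f b u (u + h) := by
  intro hj
  obtain ⟨n, k, hk, h1, -⟩ := (hj.eventually_hasGridJump hf hh).exists
  linarith [hpos n k hk.le]

end Paths

/-! ### Jump events of the process -/

/-- The event that `X` jumps from below `-b` to above `b` in `(u, v]`. -/
def jumpEvent {Ω : Type*} (X : ℝ≥0 → Ω → ℝ) (b : ℝ) (u v : ℝ≥0) : Set Ω :=
  {ω | HasJump (fun t => X t ω) b u v}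

/-- The event that `X` goes from below `-b` at time `s` to above `b` at time `t`. -/
def stepEvent {Ω : Type*} (X : ℝ≥0 → Ω → ℝ) (b : ℝ) (s t : ℝ≥0) : Set Ω :=
  X s ⁻¹' Set.Iio (-b) ∩ X t ⁻¹' Set.Ioi b

/-- The event that `X` has a jump along the `n`-th partition of `[u, u + h]`. -/
def gridEvent {Ω : Type*} (X : ℝ≥0 → Ω → ℝ) (b : ℝ) (u h : ℝ≥0) (n : ℕ) : Set Ω :=
  ⋃ k ∈ Finset.range (2 ^ n), stepEvent X b (grid u h n k) (grid u h n (k + 1))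

section Events

variable {Ω : Type*} {X : ℝ≥0 → Ω → ℝ} {b : ℝ} {u v h : ℝ≥0}

lemma mem_gridEvent {n : ℕ} {ω : Ω} :
    ω ∈ gridEvent X b u h n ↔ HasGridJump (fun t => X t ω) b u h n := by
  simp [gridEvent, stepEvent, HasGridJump, and_left_comm]

lemma jumpEvent_union {w : ℝ≥0} (huv : u ≤ v) (hvw : v ≤ w) :
    jumpEvent X b u w = jumpEvent X b u v ∪ jumpEvent X b v w := by
  ext ω
  exact hasJump_union huv hvw

lemma measurableSet_gridEvent {m : MeasurableSpace Ω} {n : ℕ}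
    (hX : ∀ t ∈ Set.Icc u (u + h), Measurable[m] (X t)) : MeasurableSet[m] (gridEvent X b u h n) := by
  refine Finset.measurableSet_biUnion _ fun k hk => ?_
  have hk' : k < 2 ^ n := Finset.mem_range.1 hk
  exact (hX _ ⟨le_grid _ _ _ _, grid_le hk'.le⟩ measurableSet_Iio).inter
    (hX _ ⟨le_grid _ _ _ _, grid_le hk'⟩ measurableSet_Ioi)

lemma measurableSet_jumpEvent {m : MeasurableSpace Ω} (hc : ∀ ω, IsCadlag fun t => X t ω)
    (hh : 0 < h) (hX : ∀ t ∈ Set.Icc u (u + h), Measurable[m] (X t)) :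
    MeasurableSet[m] (jumpEvent X b u (u + h)) := by
  have : jumpEvent X b u (u + h) = ⋃ m : ℕ, ⋃ N : ℕ, ⋂ n : ℕ, ⋂ _ : N ≤ n,
      gridEvent X (b + 1 / (m + 1)) u h n := by
    ext ω
    simp only [jumpEvent, Set.mem_ofPred_eq, hasJump_iff (hc ω) hh, eventually_atTop,
      Set.mem_iUnion, Set.mem_iInter, mem_gridEvent]
  rw [this]
  exact MeasurableSet.iUnion fun m => MeasurableSet.iUnion fun N =>
    MeasurableSet.iInter fun n => MeasurableSet.iInter fun _ => measurableSet_gridEvent hX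

lemma measurableSet_jumpEvent_past (hc : ∀ ω, IsCadlag fun t => X t ω) (hh : 0 < h) :
    MeasurableSet[past X (u + h)] (jumpEvent X b u (u + h)) :=
  measurableSet_jumpEvent hc hh fun _ ht => measurable_past ht.2

lemma measurableSet_jumpEvent_fut (hc : ∀ ω, IsCadlag fun t => X t ω) (hh : 0 < h) :
    MeasurableSet[fut X u] (jumpEvent X b u (u + h)) :=
  measurableSet_jumpEvent hc hh fun _ ht => measurable_fut ht.1

variable [MeasurableSpace Ω] {μ : Measure Ω}

/-- Fatou's inequality: `S` lies in the lower limit of the sets `T n`. -/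
lemma measure_le_of_eventually_mem {S : Set Ω} {T : ℕ → Set Ω} {K : ℝ≥0∞}
    (hS : ∀ ω ∈ S, ∀ᶠ n in atTop, ω ∈ T n) (hT : ∀ n, μ (T n) ≤ K) : μ S ≤ K := by
  have hsub : S ⊆ ⋃ N, ⋂ n, ⋂ _ : N ≤ n, T n := fun ω hω => by
    obtain ⟨N, hN⟩ := eventually_atTop.1 (hS ω hω)
    simp only [Set.mem_iUnion, Set.mem_iInter]
    exact ⟨N, hN⟩
  refine (measure_mono hsub).trans ?_
  rw [Monotone.measure_iUnion]
  · refine iSup_le fun N => (measure_mono ?_).trans (hT N)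
    exact Set.iInter₂_subset N le_rfl
  · intro N N' hN
    exact Set.iInter_mono fun n => Set.iInter_mono' fun hn => ⟨hN.trans hn, subset_rfl⟩

/-- Reverse Fatou: `S` contains the upper limit, and continuity from above uses measurability and
finiteness. -/
lemma le_measure_of_frequently_mem [IsFiniteMeasure μ] {S : Set Ω} {T : ℕ → Set Ω} {K : ℝ≥0∞}
    (hTm : ∀ n, MeasurableSet (T n))
    (hS : ∀ ω, (∃ᶠ n in atTop, ω ∈ T n) → ω ∈ S) (hT : ∀ n, K ≤ μ (T n)) : K ≤ μ S := by
  have hsub : (⋂ N, ⋃ n, ⋃ _ : N ≤ n, T n) ⊆ S := fun ω hω => by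
    refine hS ω (frequently_atTop.2 fun N => ?_)
    have := Set.mem_iInter.1 hω N
    simp only [Set.mem_iUnion] at this
    obtain ⟨n, hn, hmem⟩ := this
    exact ⟨n, hn, hmem⟩
  refine le_trans ?_ (measure_mono hsub)
  rw [Antitone.measure_iInter]
  · refine le_iInf fun N => (hT N).trans (measure_mono ?_)
    exact Set.subset_iUnion₂_of_subset N le_rfl subset_rfl
  · intro N N' hN
    exact Set.iUnion_mono fun n => Set.iUnion_mono' fun hn => ⟨hN.trans hn, subset_rfl⟩
  · exact fun N => (MeasurableSet.iUnion fun n => MeasurableSet.iUnion fun _ =>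
      hTm n).nullMeasurableSet
  · exact ⟨0, measure_ne_top _ _⟩

end Events

/-! ### Probabilities of big jumps -/

/-- Two-sided bounds on a density ratio: `r δ` is at least `k δ` for `δ ≤ 1`, at most `K` for
`δ ≥ 1 / 2`, and at most `K min(δ, 1)` for pairs that are separated by `[-b₀, b₀]`. -/
structure RatioBounds (r : ℝ≥0 → ℝ → ℝ → ℝ≥0∞) (b₀ k K : ℝ) : Prop where
  lower_pos : 0 < k
  upper_pos : 0 < K
  level_nonneg : 0 ≤ b₀
  lower : ∀ (δ : ℝ≥0) x y, δ ≤ 1 → ENNReal.ofReal (k * δ) ≤ r δ x y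
  upper : ∀ (δ : ℝ≥0) x y, 1 / 2 ≤ δ → r δ x y ≤ ENNReal.ofReal K
  far : ∀ (δ : ℝ≥0) x y, x < -b₀ → b₀ < y → r δ x y ≤ ENNReal.ofReal (K * δ)
  far_const : ∀ (δ : ℝ≥0) x y, x < -b₀ → b₀ < y → r δ x y ≤ ENNReal.ofReal K

section Real

variable {Ω : Type*} [MeasurableSpace Ω] {μ : Measure Ω} [IsProbabilityMeasure μ]

lemma measureReal_le_of_eventually_mem {S : Set Ω} {T : ℕ → Set Ω} {K : ℝ} (hK : 0 ≤ K)
    (hS : ∀ ω ∈ S, ∀ᶠ n in atTop, ω ∈ T n) (hT : ∀ n, μ.real (T n) ≤ K) : μ.real S ≤ K := by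
  refine ENNReal.toReal_le_of_le_ofReal hK (measure_le_of_eventually_mem hS fun n => ?_)
  exact (ENNReal.le_ofReal_iff_toReal_le (measure_ne_top _ _) hK).2 (hT n)

lemma le_measureReal_of_frequently_mem {S : Set Ω} {T : ℕ → Set Ω} {K : ℝ}
    (hTm : ∀ n, MeasurableSet (T n))
    (hS : ∀ ω, (∃ᶠ n in atTop, ω ∈ T n) → ω ∈ S) (hT : ∀ n, K ≤ μ.real (T n)) :
    K ≤ μ.real S := by
  refine (ENNReal.ofReal_le_iff_le_toReal (measure_ne_top _ _)).1
    (le_measure_of_frequently_mem hTm hS fun n => ?_)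
  exact (ENNReal.ofReal_le_iff_le_toReal (measure_ne_top _ _)).2 (hT n)

/-- The second Bonferroni inequality. -/
lemma sum_measureReal_le_union_add {A : ℕ → Set Ω} (hA : ∀ k, MeasurableSet (A k)) (N : ℕ) :
    ∑ k ∈ Finset.range N, μ.real (A k) ≤ μ.real (⋃ k ∈ Finset.range N, A k) +
      ∑ k ∈ Finset.range N, ∑ j ∈ Finset.range k, μ.real (A j ∩ A k) := by
  induction N with
  | zero => simp
  | succ N ih =>
    rw [Finset.sum_range_succ, Finset.sum_range_succ, Finset.range_add_one,
      Finset.set_biUnion_insert, Set.union_comm]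
    have h1 := measureReal_union_add_inter (μ := μ) (s := ⋃ k ∈ Finset.range N, A k) (hA N)
      (measure_ne_top _ _) (measure_ne_top _ _)
    have h2 : μ.real ((⋃ k ∈ Finset.range N, A k) ∩ A N) ≤
        ∑ j ∈ Finset.range N, μ.real (A j ∩ A N) := by
      rw [Set.iUnion₂_inter]
      exact measureReal_biUnion_finset_le _ _
    linarith

end Real

namespace IsStationaryMarkov

variable {Ω : Type*} [MeasurableSpace Ω] {X : ℝ≥0 → Ω → ℝ} {μ : Measure Ω}
  [IsProbabilityMeasure μ] {π : Measure ℝ} [IsProbabilityMeasure π] {r : ℝ≥0 → ℝ → ℝ → ℝ≥0∞}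
  {s t s' t' u h : ℝ≥0} {b b₀ k K : ℝ} {G H : Set Ω}

lemma measureReal_inter_le (hX : IsStationaryMarkov X μ π r) (hst : s < t)
    (hG : MeasurableSet[past X s] G) (hH : MeasurableSet[fut X t] H) {C : ℝ} (hC0 : 0 ≤ C)
    (hC : ∀ ω' ∈ G, ∀ ω ∈ H, r (t - s) (X s ω') (X t ω) ≤ ENNReal.ofReal C) :
    μ.real (G ∩ H) ≤ C * μ.real G * μ.real H := by
  have h1 := ENNReal.toReal_mono (by finiteness) (hX.measure_inter_le hst hG hH hC)
  rwa [ENNReal.toReal_mul, ENNReal.toReal_mul, ENNReal.toReal_ofReal hC0] at h1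

lemma le_measureReal_inter (hX : IsStationaryMarkov X μ π r) (hst : s < t)
    (hG : MeasurableSet[past X s] G) (hH : MeasurableSet[fut X t] H) {c : ℝ} (hc0 : 0 ≤ c)
    (hc : ∀ ω' ∈ G, ∀ ω ∈ H, ENNReal.ofReal c ≤ r (t - s) (X s ω') (X t ω)) :
    c * μ.real G * μ.real H ≤ μ.real (G ∩ H) := by
  have h1 := ENNReal.toReal_mono (measure_ne_top _ _) (hX.le_measure_inter hst hG hH hc)
  rwa [ENNReal.toReal_mul, ENNReal.toReal_mul, ENNReal.toReal_ofReal hc0] at h1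

lemma measureReal_preimage (hX : IsStationaryMarkov X μ π r) (t : ℝ≥0) {A : Set ℝ}
    (hA : MeasurableSet A) : μ.real (X t ⁻¹' A) = π.real A :=
  congrArg ENNReal.toReal (hX.measure_preimage t hA)

lemma measurableSet_stepEvent (hX : IsStationaryMarkov X μ π r) (b : ℝ) (s t : ℝ≥0) :
    MeasurableSet (stepEvent X b s t) :=
  (hX.measurable s measurableSet_Iio).inter (hX.measurable t measurableSet_Ioi)

lemma measureReal_stepEvent_inter_le (hX : IsStationaryMarkov X μ π r)
    (hr : RatioBounds r b₀ k K) (hb : b₀ ≤ b) (hst : s < t) (hH : MeasurableSet[fut X t] H) :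
    μ.real (stepEvent X b s t ∩ H) ≤
      K * (t - s : ℝ≥0) * π.real (Set.Iio (-b)) * μ.real (X t ⁻¹' Set.Ioi b ∩ H) := by
  rw [stepEvent, Set.inter_assoc, ← hX.measureReal_preimage s measurableSet_Iio]
  refine hX.measureReal_inter_le hst (measurable_past le_rfl measurableSet_Iio)
    ((measurable_fut le_rfl measurableSet_Ioi).inter hH) ?_ fun ω' hω' ω hω => ?_
  · exact mul_nonneg hr.upper_pos.le (NNReal.coe_nonneg _)
  · have h1 : X s ω' < -b := hω'
    have h2 : b < X t ω := hω.1
    exact hr.far _ _ _ (by linarith) (by linarith)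

lemma measureReal_stepEvent_le (hX : IsStationaryMarkov X μ π r)
    (hr : RatioBounds r b₀ k K) (hb : b₀ ≤ b) (hst : s < t) :
    μ.real (stepEvent X b s t) ≤
      K * (t - s : ℝ≥0) * (π.real (Set.Iio (-b)) * π.real (Set.Ioi b)) := by
  have h1 := hX.measureReal_stepEvent_inter_le hr hb hst MeasurableSet.univ
  rw [Set.inter_univ, Set.inter_univ, hX.measureReal_preimage t measurableSet_Ioi, mul_assoc] at h1
  exact h1

lemma le_measureReal_stepEvent (hX : IsStationaryMarkov X μ π r)
    (hr : RatioBounds r b₀ k K) (hst : s < t) (hst1 : t - s ≤ 1) :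
    k * (t - s : ℝ≥0) * (π.real (Set.Iio (-b)) * π.real (Set.Ioi b)) ≤
      μ.real (stepEvent X b s t) := by
  rw [← hX.measureReal_preimage s measurableSet_Iio, ← hX.measureReal_preimage t measurableSet_Ioi,
    ← mul_assoc]
  exact hX.le_measureReal_inter hst (measurable_past le_rfl measurableSet_Iio)
    (measurable_fut le_rfl measurableSet_Ioi)
    (mul_nonneg hr.lower_pos.le (NNReal.coe_nonneg _)) fun ω' _ ω _ => hr.lower _ _ _ hst1

/-- If t = s', the path would be above b ≥ 0 and below −b at once. Otherwise it must return from
above b to below −b between the steps, which costs a bounded factor K by symmetry, however short the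
time; each step brings a further K. -/
lemma measureReal_stepEvent_inter_stepEvent_le (hX : IsStationaryMarkov X μ π r)
    (hr : RatioBounds r b₀ k K) (hb : b₀ ≤ b) (hst : s < t) (hts : t ≤ s') (hst' : s' < t') :
    μ.real (stepEvent X b s t ∩ stepEvent X b s' t') ≤
      K ^ 3 * (t - s : ℝ≥0) * (t' - s' : ℝ≥0) *
        (π.real (Set.Iio (-b)) * π.real (Set.Ioi b)) ^ 2 := by
  have hK := hr.upper_pos
  have hb0 : 0 ≤ b := hr.level_nonneg.trans hb
  have hP : 0 ≤ π.real (Set.Iio (-b)) * π.real (Set.Ioi b) := by positivity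
  rcases hts.eq_or_lt with rfl | hlt
  · have : stepEvent X b s t ∩ stepEvent X b t t' = ∅ := by
      ext ω
      simp only [stepEvent, Set.mem_inter_iff, Set.mem_preimage, Set.mem_Iio, Set.mem_Ioi,
        Set.mem_empty_iff_false, iff_false]
      rintro ⟨⟨-, h1⟩, h2, -⟩
      linarith
    rw [this, measureReal_empty]
    positivity
  · have hG : MeasurableSet[past X t] (stepEvent X b s t) :=
      (measurable_past hst.le measurableSet_Iio).inter (measurable_past le_rfl measurableSet_Ioi)
    have hH : MeasurableSet[fut X s'] (stepEvent X b s' t') :=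
      (measurable_fut le_rfl measurableSet_Iio).inter (measurable_fut hst'.le measurableSet_Ioi)
    have h1 := hX.measureReal_inter_le hlt hG hH hK.le fun ω' hω' ω hω => by
      have e1 : b < X t ω' := hω'.2
      have e2 : X s' ω < -b := hω.1
      rw [hX.symm]
      exact hr.far_const _ _ _ (by linarith) (by linarith)
    refine h1.trans ?_
    calc K * μ.real (stepEvent X b s t) * μ.real (stepEvent X b s' t')
        ≤ K * (K * (t - s : ℝ≥0) * (π.real (Set.Iio (-b)) * π.real (Set.Ioi b))) *
          (K * (t' - s' : ℝ≥0) * (π.real (Set.Iio (-b)) * π.real (Set.Ioi b))) := by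
          gcongr
          · exact hX.measureReal_stepEvent_le hr hb hst
          · exact hX.measureReal_stepEvent_le hr hb hst'
      _ = _ := by ring

lemma grid_succ_sub (u h : ℝ≥0) (n k : ℕ) :
    ((grid u h n (k + 1) - grid u h n k : ℝ≥0) : ℝ) = h / 2 ^ n := by
  rw [grid_succ, add_tsub_cancel_left]
  push_cast
  rfl

/-- A jump rarely precedes a given future event. -/
lemma measureReal_jumpEvent_inter_le (hX : IsStationaryMarkov X μ π r)
    (hr : RatioBounds r b₀ k K) (hc : ∀ ω, IsCadlag fun t => X t ω) (hb : b₀ ≤ b) (hh : 0 < h)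
    (hH : MeasurableSet[fut X (u + h)] H) :
    μ.real (jumpEvent X b u (u + h) ∩ H) ≤ K * h * π.real (Set.Iio (-b)) * μ.real H := by
  have hK := hr.upper_pos
  refine measureReal_le_of_eventually_mem (T := fun n => gridEvent X b u h n ∩ H) (by positivity)
    (fun ω hω => ?_) fun n => ?_
  · filter_upwards [HasJump.eventually_hasGridJump (hc ω) hh hω.1] with n hn
    exact ⟨mem_gridEvent.2 hn, hω.2⟩
  · rw [gridEvent, Set.iUnion₂_inter]
    refine (measureReal_biUnion_finset_le _ _).trans ?_
    have hstep : ∀ j ∈ Finset.range (2 ^ n),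
        μ.real (stepEvent X b (grid u h n j) (grid u h n (j + 1)) ∩ H) ≤
          K * (h / 2 ^ n) * π.real (Set.Iio (-b)) * μ.real H := fun j hj => by
      have hj' : j < 2 ^ n := Finset.mem_range.1 hj
      refine (hX.measureReal_stepEvent_inter_le hr hb (grid_lt_succ hh n j)
        (fut_anti (grid_le hj') _ hH)).trans ?_
      rw [grid_succ_sub]
      gcongr
      · exact measure_ne_top _ _
      · exact Set.inter_subset_right
    refine (Finset.sum_le_sum hstep).trans (le_of_eq ?_)
    rw [Finset.sum_const, Finset.card_range, nsmul_eq_mul]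
    push_cast
    field_simp

/-- Jumps in two adjacent intervals. -/
lemma measureReal_jumpEvent_inter_jumpEvent_le (hX : IsStationaryMarkov X μ π r)
    (hr : RatioBounds r b₀ k K) (hc : ∀ ω, IsCadlag fun t => X t ω) (hb : b₀ ≤ b) (hh : 0 < h) :
    μ.real (jumpEvent X b u (u + h) ∩ jumpEvent X b (u + h) (u + h + h)) ≤
      K ^ 3 * h ^ 2 * (π.real (Set.Iio (-b)) * π.real (Set.Ioi b)) ^ 2 := by
  have hK := hr.upper_pos
  refine measureReal_le_of_eventually_mem
    (T := fun n => gridEvent X b u h n ∩ gridEvent X b (u + h) h n) (by positivity)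
    (fun ω hω => ?_) fun n => ?_
  · filter_upwards [HasJump.eventually_hasGridJump (hc ω) hh hω.1,
      HasJump.eventually_hasGridJump (hc ω) hh hω.2] with n hn hn'
    exact ⟨mem_gridEvent.2 hn, mem_gridEvent.2 hn'⟩
  · rw [gridEvent, Set.iUnion₂_inter]
    refine (measureReal_biUnion_finset_le _ _).trans ?_
    set P := π.real (Set.Iio (-b)) * π.real (Set.Ioi b) with hP
    have hstep : ∀ j ∈ Finset.range (2 ^ n),
        μ.real (stepEvent X b (grid u h n j) (grid u h n (j + 1)) ∩ gridEvent X b (u + h) h n) ≤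
          K ^ 3 * (h / 2 ^ n) * h * P ^ 2 := fun j hj => by
      rw [gridEvent, Set.inter_iUnion₂]
      refine (measureReal_biUnion_finset_le _ _).trans ?_
      have hj' : j < 2 ^ n := Finset.mem_range.1 hj
      have hstep' : ∀ i ∈ Finset.range (2 ^ n),
          μ.real (stepEvent X b (grid u h n j) (grid u h n (j + 1)) ∩
            stepEvent X b (grid (u + h) h n i) (grid (u + h) h n (i + 1))) ≤
            K ^ 3 * (h / 2 ^ n) * (h / 2 ^ n) * P ^ 2 := fun i _ => by
        have := hX.measureReal_stepEvent_inter_stepEvent_le hr hb (grid_lt_succ hh n j)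
          ((grid_le hj').trans (le_grid (u + h) h n i)) (grid_lt_succ hh n i)
        rwa [grid_succ_sub, grid_succ_sub] at this
      refine (Finset.sum_le_sum hstep').trans (le_of_eq ?_)
      rw [Finset.sum_const, Finset.card_range, nsmul_eq_mul]
      push_cast
      field_simp
    refine (Finset.sum_le_sum hstep).trans (le_of_eq ?_)
    rw [Finset.sum_const, Finset.card_range, nsmul_eq_mul]
    push_cast
    field_simp

/-- The 2^n single steps contribute khP in total, and at most 4^n pairs cost K³(h/2^n)²P² each, so
the Bonferroni bound does not depend on n. -/
lemma le_measureReal_gridEvent (hX : IsStationaryMarkov X μ π r)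
    (hr : RatioBounds r b₀ k K) (hb : b₀ ≤ b) (hh : 0 < h) (hh1 : h ≤ 1) (n : ℕ) :
    k * h * (π.real (Set.Iio (-b)) * π.real (Set.Ioi b)) -
      K ^ 3 * h ^ 2 * (π.real (Set.Iio (-b)) * π.real (Set.Ioi b)) ^ 2 ≤
      μ.real (gridEvent X b u h n) := by
  have hK := hr.upper_pos
  set P := π.real (Set.Iio (-b)) * π.real (Set.Ioi b) with hP
  set A := fun j : ℕ => stepEvent X b (grid u h n j) (grid u h n (j + 1)) with hA
  have h1 := sum_measureReal_le_union_add (μ := μ) (A := A)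
    (fun j => hX.measurableSet_stepEvent _ _ _) (2 ^ n)
  have h2 : k * h * P ≤ ∑ j ∈ Finset.range (2 ^ n), μ.real (A j) := by
    have hstep : ∀ j ∈ Finset.range (2 ^ n), k * (h / 2 ^ n) * P ≤ μ.real (A j) := fun j _ => by
      have := hX.le_measureReal_stepEvent (b := b) hr (grid_lt_succ (u := u) hh n j) (by
        rw [grid_succ, add_tsub_cancel_left]
        refine (div_le_self zero_le ?_).trans hh1
        exact one_le_pow₀ (by norm_num))
      rwa [grid_succ_sub] at this
    refine le_trans (le_of_eq ?_) (Finset.sum_le_sum hstep)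
    rw [Finset.sum_const, Finset.card_range, nsmul_eq_mul]
    push_cast
    field_simp
  have h3 : ∑ i ∈ Finset.range (2 ^ n), ∑ j ∈ Finset.range i, μ.real (A j ∩ A i) ≤
      K ^ 3 * h ^ 2 * P ^ 2 := by
    have hstep : ∀ i ∈ Finset.range (2 ^ n), ∑ j ∈ Finset.range i, μ.real (A j ∩ A i) ≤
        2 ^ n * (K ^ 3 * (h / 2 ^ n) * (h / 2 ^ n) * P ^ 2) := fun i hi => by
      have hstep' : ∀ j ∈ Finset.range i, μ.real (A j ∩ A i) ≤
          K ^ 3 * (h / 2 ^ n) * (h / 2 ^ n) * P ^ 2 := fun j hj => by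
        have := hX.measureReal_stepEvent_inter_stepEvent_le hr hb (grid_lt_succ (u := u) hh n j)
          (grid_mono (u := u) (h := h) (n := n) (Finset.mem_range.1 hj)) (grid_lt_succ hh n i)
        rwa [grid_succ_sub, grid_succ_sub] at this
      refine (Finset.sum_le_sum hstep').trans ?_
      rw [Finset.sum_const, Finset.card_range, nsmul_eq_mul]
      have hi' : (i : ℝ) ≤ 2 ^ n := by exact_mod_cast (Finset.mem_range.1 hi).le
      gcongr
    refine (Finset.sum_le_sum hstep).trans (le_of_eq ?_)
    rw [Finset.sum_const, Finset.card_range, nsmul_eq_mul]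
    push_cast
    field_simp
  change _ ≤ μ.real (⋃ j ∈ Finset.range (2 ^ n), A j)
  linarith

/-- As the levels decrease to b, the open half-lines increase to those at b. This recovers the level
lost in passing from grid jumps to path jumps. -/
lemma tendsto_measureReal_levels (π : Measure ℝ) [IsProbabilityMeasure π] (b : ℝ) :
    Tendsto (fun m : ℕ => π.real (Set.Iio (-(b + 1 / (m + 1)))) * π.real (Set.Ioi (b + 1 / (m + 1))))
      atTop (𝓝 (π.real (Set.Iio (-b)) * π.real (Set.Ioi b))) := by
  have hanti : Antitone fun m : ℕ => b + 1 / ((m : ℝ) + 1) := fun m m' hm => by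
    have : (m : ℝ) ≤ m' := by exact_mod_cast hm
    simp only
    gcongr
  have hlim : ∀ x : ℝ, b < x → ∃ m : ℕ, b + 1 / ((m : ℝ) + 1) < x := fun x hx => by
    obtain ⟨m, hm⟩ := exists_nat_one_div_lt (sub_pos.2 hx)
    exact ⟨m, by linarith⟩
  have hpos : ∀ m : ℕ, 0 < 1 / ((m : ℝ) + 1) := fun m => Nat.one_div_pos_of_nat
  have e1 : Set.Iio (-b) = ⋃ m : ℕ, Set.Iio (-(b + 1 / ((m : ℝ) + 1))) := by
    ext x
    simp only [Set.mem_Iio, Set.mem_iUnion]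
    constructor
    · intro hx
      obtain ⟨m, hm⟩ := hlim (-x) (by linarith)
      exact ⟨m, by linarith⟩
    · rintro ⟨m, hm⟩
      linarith [hpos m]
  have e2 : Set.Ioi b = ⋃ m : ℕ, Set.Ioi (b + 1 / ((m : ℝ) + 1)) := by
    ext x
    simp only [Set.mem_Ioi, Set.mem_iUnion]
    constructor
    · exact fun hx => hlim x hx
    · rintro ⟨m, hm⟩
      linarith [hpos m]
  refine Tendsto.mul ?_ ?_
  · rw [e1]
    refine (ENNReal.tendsto_toReal (measure_ne_top _ _)).comp (tendsto_measure_iUnion_atTop ?_)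
    exact fun m m' hm => Set.Iio_subset_Iio (by linarith [hanti hm])
  · rw [e2]
    refine (ENNReal.tendsto_toReal (measure_ne_top _ _)).comp (tendsto_measure_iUnion_atTop ?_)
    exact fun m m' hm => Set.Ioi_subset_Ioi (hanti hm)

/-- A lower bound for the probability of a jump. -/
lemma le_measureReal_jumpEvent (hX : IsStationaryMarkov X μ π r)
    (hr : RatioBounds r b₀ k K) (hc : ∀ ω, IsCadlag fun t => X t ω) (hb : b₀ ≤ b) (hh : 0 < h)
    (hh1 : h ≤ 1) :
    k * h * (π.real (Set.Iio (-b)) * π.real (Set.Ioi b)) -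
      K ^ 3 * h ^ 2 * (π.real (Set.Iio (-b)) * π.real (Set.Ioi b)) ^ 2 ≤
      μ.real (jumpEvent X b u (u + h)) := by
  have hP := tendsto_measureReal_levels π b
  refine le_of_tendsto' ((hP.const_mul (k * h)).sub ((hP.pow 2).const_mul (K ^ 3 * h ^ 2)))
    fun m => ?_
  have hm : 0 < 1 / ((m : ℝ) + 1) := Nat.one_div_pos_of_nat
  refine le_measureReal_of_frequently_mem (T := gridEvent X (b + 1 / (m + 1)) u h)
    (fun n => measurableSet_gridEvent fun t _ => hX.measurable t) (fun ω hω => ?_)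
    fun n => hX.le_measureReal_gridEvent hr (by linarith) hh hh1 n
  exact hasJump_of_frequently (hc ω) hh (by linarith) (hω.mono fun n hn => mem_gridEvent.1 hn)

end IsStationaryMarkov

/-! ### Staying positive -/

/-- The density at the final time of the event that `n` steps of length `δ` stay positive. -/
def survive (π : Measure ℝ) (r : ℝ≥0 → ℝ → ℝ → ℝ≥0∞) (δ : ℝ≥0) : ℕ → ℝ → ℝ≥0∞
  | 0 => (Set.Ioi 0).indicator 1
  | n + 1 => (Set.Ioi 0).indicator fun y => ∫⁻ x, r δ x y * survive π r δ n x ∂π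

/-- The event that `X` is positive at the times `s + i δ`, `i ≤ n`. -/
def posEvent {Ω : Type*} (X : ℝ≥0 → Ω → ℝ) (s δ : ℝ≥0) (n : ℕ) : Set Ω :=
  ⋂ i ∈ Finset.range (n + 1), X (s + i * δ) ⁻¹' Set.Ioi 0

/-- The probability that a process is positive on all dyadic grids of the unit interval. -/
def stayProb (π : Measure ℝ) (r : ℝ≥0 → ℝ → ℝ → ℝ≥0∞) : ℝ≥0∞ :=
  ⨅ N : ℕ, ∫⁻ x, survive π r (1 / 2 ^ N) (2 ^ N) x ∂π

lemma sq_lintegral_le {α : Type*} [MeasurableSpace α] {π : Measure α} [IsProbabilityMeasure π]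
    {f : α → ℝ≥0∞} (hf : Measurable f) : (∫⁻ x, f x ∂π) ^ 2 ≤ ∫⁻ x, f x * f x ∂π := by
  have h := ENNReal.lintegral_mul_le_Lp_mul_Lq π (p := 2) (q := 2) (by constructor <;> norm_num)
    hf.aemeasurable (g := 1) aemeasurable_const
  simp only [Pi.mul_apply, Pi.one_apply, mul_one, ENNReal.one_rpow, lintegral_one, measure_univ]
    at h
  calc _ ≤ ((∫⁻ x, f x ^ (2 : ℝ) ∂π) ^ (1 / 2 : ℝ)) ^ 2 := by gcongr
    _ = ∫⁻ x, f x ^ (2 : ℝ) ∂π := by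
        rw [← ENNReal.rpow_natCast, ← ENNReal.rpow_mul]; norm_num
    _ = _ := by simp [sq]

namespace IsStationaryMarkov

variable {Ω : Type*} [MeasurableSpace Ω] {X : ℝ≥0 → Ω → ℝ} {μ : Measure Ω}
  [IsProbabilityMeasure μ] {π : Measure ℝ} [IsProbabilityMeasure π] {r : ℝ≥0 → ℝ → ℝ → ℝ≥0∞}
  {s δ : ℝ≥0} {G : Set Ω}

lemma setLIntegral_comp_of_density (hX : IsStationaryMarkov X μ π r)
    {f g : ℝ → ℝ≥0∞} (hf : Measurable f) (hg : Measurable g)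
    (h : ∀ A, MeasurableSet A → μ (G ∩ X s ⁻¹' A) = ∫⁻ y in A, f y ∂π) :
    ∫⁻ ω in G, g (X s ω) ∂μ = ∫⁻ y, g y * f y ∂π := by
  have key : (μ.restrict G).map (X s) = π.withDensity f := by
    ext A hA
    rw [Measure.map_apply (hX.measurable s) hA, withDensity_apply _ hA,
      Measure.restrict_apply (hX.measurable s hA), Set.inter_comm, h A hA]
  rw [← lintegral_map hg (hX.measurable s), key, lintegral_withDensity_eq_lintegral_mul _ hf hg]
  exact lintegral_congr fun y => mul_comm _ _

lemma measurable_survive (hX : IsStationaryMarkov X μ π r) (hδ : 0 < δ) (n : ℕ) :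
    Measurable (survive π r δ n) := by
  induction n with
  | zero => exact measurable_one.indicator measurableSet_Ioi
  | succ n ih =>
    refine Measurable.indicator ?_ measurableSet_Ioi
    have h1 : Measurable fun z : ℝ × ℝ => r δ z.2 z.1 * survive π r δ n z.2 :=
      ((hX.measurable_ratio δ hδ).comp measurable_swap).mul (ih.comp measurable_snd)
    exact h1.lintegral_prod_right'

lemma measurableSet_posEvent_past (s δ : ℝ≥0) (n : ℕ) :
    MeasurableSet[past X (s + n * δ)] (posEvent X s δ n) := by
  refine Finset.measurableSet_biInter _ fun i hi => measurable_past ?_ measurableSet_Ioi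
  have : i ≤ n := Nat.lt_succ_iff.1 (Finset.mem_range.1 hi)
  gcongr

lemma measurableSet_posEvent_fut (s δ : ℝ≥0) (n : ℕ) :
    MeasurableSet[fut X s] (posEvent X s δ n) :=
  Finset.measurableSet_biInter _ fun _ _ => measurable_fut le_self_add measurableSet_Ioi

lemma mem_posEvent {n : ℕ} {ω : Ω} :
    ω ∈ posEvent X s δ n ↔ ∀ i ≤ n, 0 < X (s + i * δ) ω := by
  simp [posEvent]

lemma posEvent_succ (X : ℝ≥0 → Ω → ℝ) (s δ : ℝ≥0) (n : ℕ) :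
    posEvent X s δ (n + 1) = posEvent X s δ n ∩ X (s + (n + 1 : ℕ) * δ) ⁻¹' Set.Ioi 0 := by
  rw [posEvent, Finset.range_add_one, Finset.set_biInter_insert, Set.inter_comm]
  rfl

lemma posEvent_add (X : ℝ≥0 → Ω → ℝ) (s δ : ℝ≥0) (m n : ℕ) :
    posEvent X s δ (m + n) = posEvent X s δ m ∩ posEvent X (s + m * δ) δ n := by
  ext ω
  simp only [posEvent, Set.mem_iInter, Finset.mem_range, Set.mem_preimage, Set.mem_Ioi,
    Set.mem_inter_iff]
  constructor
  · refine fun h => ⟨fun i hi => h i (by omega), fun i hi => ?_⟩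
    have := h (m + i) (by omega)
    push_cast at this
    rwa [add_mul, ← add_assoc] at this
  · rintro ⟨h1, h2⟩ i hi
    rcases lt_or_ge i (m + 1) with h | h
    · exact h1 i h
    · obtain ⟨j, rfl⟩ : ∃ j, i = m + j := ⟨i - m, by omega⟩
      have := h2 j (by omega)
      push_cast
      rwa [add_mul, ← add_assoc]

lemma posEvent_zero (X : ℝ≥0 → Ω → ℝ) (s δ : ℝ≥0) :
    posEvent X s δ 0 = X s ⁻¹' Set.Ioi 0 := by
  simp [posEvent]

lemma setLIntegral_survive_zero (A : Set ℝ) (δ : ℝ≥0) :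
    ∫⁻ y in A, survive π r δ 0 y ∂π = π (Set.Ioi 0 ∩ A) := by
  rw [survive, lintegral_indicator_one measurableSet_Ioi,
    Measure.restrict_apply measurableSet_Ioi]

/-- `survive` is the density of the survival event at the final time. -/
lemma measure_posEvent_inter_last (hX : IsStationaryMarkov X μ π r) (hδ : 0 < δ) (s : ℝ≥0)
    (n : ℕ) : ∀ A, MeasurableSet A →
      μ (posEvent X s δ n ∩ X (s + n * δ) ⁻¹' A) = ∫⁻ y in A, survive π r δ n y ∂π := by
  induction n with
  | zero =>
    intro A hA
    rw [setLIntegral_survive_zero, posEvent_zero, Nat.cast_zero, zero_mul, add_zero,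
      ← Set.preimage_inter, hX.measure_preimage s (measurableSet_Ioi.inter hA)]
  | succ n ih =>
    intro A hA
    have hlt : s + n * δ < s + (n + 1 : ℕ) * δ := by
      push_cast
      rw [add_mul, ← add_assoc, one_mul]
      exact lt_add_of_pos_right _ hδ
    have hsub : s + (n + 1 : ℕ) * δ - (s + n * δ) = δ := by
      push_cast
      rw [add_mul, ← add_assoc, one_mul, add_tsub_cancel_left]
    rw [posEvent_succ, Set.inter_assoc, ← Set.preimage_inter,
      hX.measure_inter_preimage hlt (measurableSet_posEvent_past s δ n)
        (measurableSet_Ioi.inter hA), hsub, survive, setLIntegral_indicator measurableSet_Ioi]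
    refine lintegral_congr fun y => ?_
    exact hX.setLIntegral_comp_of_density (g := fun x => r δ x y)
      (hX.measurable_survive hδ n)
      ((hX.measurable_ratio δ hδ).comp (measurable_id.prodMk measurable_const)) ih

/-- By symmetry, `survive` is also the density of the survival event at the initial time. -/
lemma measure_posEvent_inter_first (hX : IsStationaryMarkov X μ π r) (hδ : 0 < δ)
    (n : ℕ) : ∀ s A, MeasurableSet A →
      μ (posEvent X s δ n ∩ X s ⁻¹' A) = ∫⁻ y in A, survive π r δ n y ∂π := by
  induction n with
  | zero =>
    intro s A hA
    rw [setLIntegral_survive_zero, posEvent_zero, ← Set.preimage_inter,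
      hX.measure_preimage s (measurableSet_Ioi.inter hA)]
  | succ n ih =>
    intro s A hA
    have hlt : s < s + δ := lt_add_of_pos_right _ hδ
    have hsub : s + δ - s = δ := add_tsub_cancel_left _ _
    have hB : MeasurableSet (Set.Ioi (0 : ℝ) ∩ A) := measurableSet_Ioi.inter hA
    have hset : posEvent X s δ (n + 1) ∩ X s ⁻¹' A =
        X s ⁻¹' (Set.Ioi 0 ∩ A) ∩ posEvent X (s + δ) δ n := by
      have e : posEvent X s δ (1 + n) = X s ⁻¹' Set.Ioi 0 ∩ posEvent X (s + δ) δ n := by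
        ext ω
        rw [posEvent_add, Nat.cast_one, one_mul]
        simp only [Set.mem_inter_iff, mem_posEvent, Set.mem_preimage, Set.mem_Ioi]
        refine and_congr_left fun h2 => ⟨fun h1 => by simpa using h1 0 zero_le_one, fun h1 i hi => ?_⟩
        interval_cases i
        · simpa using h1
        · simpa using h2 0 (Nat.zero_le n)
      rw [add_comm n 1, e, Set.preimage_inter]
      ext ω
      simp only [Set.mem_inter_iff]
      tauto
    have hr : Measurable fun z : ℝ × ℝ => r δ z.1 z.2 := hX.measurable_ratio δ hδ
    have hm : Measurable fun y => ∫⁻ x in Set.Ioi (0 : ℝ) ∩ A, r δ x y ∂π :=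
      (hr.comp measurable_swap).lintegral_prod_right'
    rw [hset, hX.measure_inter_eq hlt (measurable_past le_rfl hB)
      (measurableSet_posEvent_fut (s + δ) δ n), hsub]
    calc _ = ∫⁻ ω in posEvent X (s + δ) δ n,
          ∫⁻ x in Set.Ioi (0 : ℝ) ∩ A, r δ x (X (s + δ) ω) ∂π ∂μ :=
          lintegral_congr fun ω => hX.setLIntegral_comp s hB (g := fun x => r δ x (X (s + δ) ω))
            (hr.comp (measurable_id.prodMk measurable_const))
      _ = ∫⁻ y, (∫⁻ x in Set.Ioi (0 : ℝ) ∩ A, r δ x y ∂π) * survive π r δ n y ∂π :=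
          hX.setLIntegral_comp_of_density (g := fun y => ∫⁻ x in Set.Ioi (0 : ℝ) ∩ A, r δ x y ∂π)
            (hX.measurable_survive hδ n) hm (ih (s + δ))
      _ = ∫⁻ y, ∫⁻ x in Set.Ioi (0 : ℝ) ∩ A, r δ x y * survive π r δ n y ∂π ∂π :=
          lintegral_congr fun y => (lintegral_mul_const _
            (hr.comp (measurable_id.prodMk measurable_const))).symm
      _ = ∫⁻ x in Set.Ioi (0 : ℝ) ∩ A, ∫⁻ y, r δ x y * survive π r δ n y ∂π ∂π :=
          lintegral_lintegral_swap ((hr.comp measurable_swap).mul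
            ((hX.measurable_survive hδ n).comp measurable_fst)).aemeasurable
      _ = _ := by
          rw [survive, setLIntegral_indicator measurableSet_Ioi]
          exact lintegral_congr fun x => lintegral_congr fun y => by rw [hX.symm δ x y]

lemma measure_posEvent (hX : IsStationaryMarkov X μ π r) (hδ : 0 < δ) (s : ℝ≥0) (n : ℕ) :
    μ (posEvent X s δ n) = ∫⁻ y, survive π r δ n y ∂π := by
  simpa using hX.measure_posEvent_inter_last hδ s n Set.univ MeasurableSet.univ

/-- Reversibility makes the survival probability supermultiplicative under doubling. -/
lemma sq_measure_posEvent_le (hX : IsStationaryMarkov X μ π r) (hδ : 0 < δ) (n : ℕ) :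
    μ (posEvent X 0 δ n) ^ 2 ≤ μ (posEvent X 0 δ (n + n)) := by
  -- At the middle time the first half has density `survive`, and by reversal so has the second
  -- half. The probability of the whole is therefore the integral of its square.
  rw [posEvent_add, hX.measure_inter_eq_of_density (measurableSet_posEvent_past 0 δ n)
      (measurableSet_posEvent_fut _ δ n) (hX.measurable_survive hδ n)
      (hX.measure_posEvent_inter_last hδ 0 n),
    hX.setLIntegral_comp_of_density (hX.measurable_survive hδ n) (hX.measurable_survive hδ n)
      (hX.measure_posEvent_inter_first hδ n _), hX.measure_posEvent hδ]
  exact sq_lintegral_le (hX.measurable_survive hδ n)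

lemma pow_measure_posEvent_le (hX : IsStationaryMarkov X μ π r) (hδ : 0 < δ) (n j : ℕ) :
    μ (posEvent X 0 δ n) ^ 2 ^ j ≤ μ (posEvent X 0 δ (n * 2 ^ j)) := by
  induction j with
  | zero => simp
  | succ j ih =>
    calc μ (posEvent X 0 δ n) ^ 2 ^ (j + 1) = (μ (posEvent X 0 δ n) ^ 2 ^ j) ^ 2 := by
          rw [← pow_mul, pow_succ]
      _ ≤ μ (posEvent X 0 δ (n * 2 ^ j)) ^ 2 := by gcongr
      _ ≤ _ := hX.sq_measure_posEvent_le hδ _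
      _ = _ := by rw [pow_succ]; congr 2; ring

lemma posEvent_dyadic_anti {M N : ℕ} (hMN : M ≤ N) :
    posEvent X 0 (1 / 2 ^ N) (2 ^ N) ⊆ posEvent X 0 (1 / 2 ^ M) (2 ^ M) := by
  intro ω hω
  rw [mem_posEvent] at hω ⊢
  intro i hi
  obtain ⟨d, rfl⟩ := Nat.exists_eq_add_of_le hMN
  have := hω (i * 2 ^ d) (by rw [pow_add]; gcongr)
  convert this using 3
  push_cast
  rw [pow_add]
  field_simp

/-- `stayProb` is built from π and r alone, so identifying it for one process yields a bound common
to all processes with these data. -/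
lemma stayProb_eq (hX : IsStationaryMarkov X μ π r) :
    stayProb π r = μ (⋂ N : ℕ, posEvent X 0 (1 / 2 ^ N) (2 ^ N)) := by
  rw [Antitone.measure_iInter (fun M N h => posEvent_dyadic_anti h)
    (fun N => (hX.fut_le _ _ (measurableSet_posEvent_fut _ _ _)).nullMeasurableSet)
    ⟨0, measure_ne_top _ _⟩, stayProb]
  exact iInf_congr fun N => (hX.measure_posEvent (by positivity) 0 _).symm

lemma stayProb_le (hX : IsStationaryMarkov X μ π r) (hc : ∀ ω, IsCadlag fun t => X t ω) {b : ℝ}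
    (hb : 0 ≤ b) : stayProb π r ≤ μ (jumpEvent X b 0 1)ᶜ := by
  rw [hX.stayProb_eq]
  refine measure_mono fun ω hω => ?_
  have := not_hasJump_of_pos (u := 0) (h := 1) (hc ω) one_pos hb fun n k hk => by
    have h1 := mem_posEvent.1 (Set.mem_iInter.1 hω n) k hk
    convert h1 using 2
    unfold grid
    ring
  rwa [zero_add] at this

/-- By right continuity a path with X_0 > 0 is positive at the dyadic points of some [0, 2^{-M}],
and one M works with positive probability. Then M doublings reach the unit interval at the cost of a
2^M-th power, whatever the mesh. -/
lemma stayProb_pos (hX : IsStationaryMarkov X μ π r) (hc : ∀ ω, IsCadlag fun t => X t ω)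
    (hπ : π (Set.Ioi 0) ≠ 0) : 0 < stayProb π r := by
  set F : ℕ → Set Ω := fun M => ⋂ d : ℕ, posEvent X 0 (1 / 2 ^ (M + d)) (2 ^ d) with hF
  obtain ⟨M, hM⟩ : ∃ M, μ (F M) ≠ 0 := by
    by_contra! hzero
    have hsub : X 0 ⁻¹' Set.Ioi 0 ⊆ ⋃ M, F M := by
      intro ω hω
      have hev : ∀ᶠ x in 𝓝[≥] (0 : ℝ≥0), 0 < X x ω := (hc ω 0).1.eventually_const_lt hω
      obtain ⟨v, hv, hsub⟩ := mem_nhdsGE_iff_exists_Ico_subset.1 hev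
      have hv0 : (0 : ℝ) < v := by exact_mod_cast hv
      obtain ⟨M, hM⟩ := ((tendsto_mesh 1).eventually_lt_const hv0).exists
      refine Set.mem_iUnion.2 ⟨M, Set.mem_iInter.2 fun d => mem_posEvent.2 fun i hi => ?_⟩
      refine hsub ⟨zero_le, ?_⟩
      have hi' : (i : ℝ) ≤ 2 ^ d := by exact_mod_cast hi
      have hle : (i : ℝ) * (1 / 2 ^ (M + d)) ≤ 1 / 2 ^ M := by
        calc (i : ℝ) * (1 / 2 ^ (M + d)) ≤ 2 ^ d * (1 / 2 ^ (M + d)) := by gcongr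
          _ = _ := by rw [pow_add]; field_simp
      have hM' : (1 : ℝ) / 2 ^ M < v := by simpa using hM
      rw [zero_add]
      exact_mod_cast (show ((i * (1 / 2 ^ (M + d)) : ℝ≥0) : ℝ) < v by
        push_cast; linarith)
    have h0 : μ (X 0 ⁻¹' Set.Ioi 0) = 0 := measure_mono_null hsub (measure_iUnion_null hzero)
    rw [hX.measure_preimage 0 measurableSet_Ioi] at h0
    exact hπ h0
  have hlow : ∀ d, μ (F M) ^ 2 ^ M ≤ μ (posEvent X 0 (1 / 2 ^ (M + d)) (2 ^ (M + d))) := fun d => by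
    calc μ (F M) ^ 2 ^ M ≤ μ (posEvent X 0 (1 / 2 ^ (M + d)) (2 ^ d)) ^ 2 ^ M := by
          gcongr
          exact Set.iInter_subset _ d
      _ ≤ _ := hX.pow_measure_posEvent_le (by positivity) _ _
      _ = _ := by rw [← pow_add, add_comm d M]
  refine (ENNReal.pow_pos (pos_iff_ne_zero.2 hM) (2 ^ M)).trans_le (le_iInf fun N => ?_)
  rw [← hX.measure_posEvent (by positivity) 0]
  calc _ ≤ μ (posEvent X 0 (1 / 2 ^ (M + N)) (2 ^ (M + N))) := hlow N
    _ ≤ _ := measure_mono (posEvent_dyadic_anti (Nat.le_add_left N M))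

end IsStationaryMarkov

/-! ### Mixing without a gap -/

namespace IsStationaryMarkov

variable {Ω : Type*} [MeasurableSpace Ω] {X : ℝ≥0 → Ω → ℝ} {μ : Measure Ω}
  [IsProbabilityMeasure μ] {π : Measure ℝ} [IsProbabilityMeasure π] {r : ℝ≥0 → ℝ → ℝ → ℝ≥0∞}
  {s t : ℝ≥0} {b b₀ k K : ℝ} {G H : Set Ω}

lemma measureReal_inter_le_of_gap (hX : IsStationaryMarkov X μ π r) (hr : RatioBounds r b₀ k K)
    (hst : s + 1 / 2 ≤ t) (hG : MeasurableSet[past X s] G) (hH : MeasurableSet[fut X t] H) :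
    μ.real (G ∩ H) ≤ K * μ.real G * μ.real H :=
  hX.measureReal_inter_le (lt_of_lt_of_le (lt_add_of_pos_right s (by positivity)) hst) hG hH
    hr.upper_pos.le fun _ _ _ _ => hr.upper _ _ _ (le_tsub_of_add_le_left hst)

lemma abs_measureReal_inter_sub_le (hX : IsStationaryMarkov X μ π r) {η : ℝ} (hη : 0 ≤ η)
    (hst : s < t) (hlow : ∀ x y, ENNReal.ofReal (1 - η) ≤ r (t - s) x y)
    (hup : ∀ x y, r (t - s) x y ≤ ENNReal.ofReal (1 + η))
    (hG : MeasurableSet[past X s] G) (hH : MeasurableSet[fut X t] H) :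
    |μ.real (G ∩ H) - μ.real G * μ.real H| ≤ η * μ.real G * μ.real H := by
  have h1 := hX.measureReal_inter_le hst hG hH (by positivity) fun _ _ _ _ => hup _ _
  -- η may exceed 1, and only the positive part of 1 − η is visible in `ENNReal`.
  have h2 := hX.le_measureReal_inter hst hG hH (c := max (1 - η) 0) (le_max_right _ _)
    fun _ _ _ _ => by
      rw [ENNReal.ofReal_max, ENNReal.ofReal_zero, max_eq_left zero_le]
      exact hlow _ _
  have h3 : (1 - η) * μ.real G * μ.real H ≤ max (1 - η) 0 * μ.real G * μ.real H := by
    gcongr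
    exact le_max_left _ _
  rw [abs_le]
  constructor <;> nlinarith

/-- With h = 1/2 the Bonferroni bound is kP/2 − K³P²/4, and the smallness hypothesis gives K³P ≤ k.
-/
lemma quarter_le_measureReal_jumpEvent (hX : IsStationaryMarkov X μ π r)
    (hr : RatioBounds r b₀ k K) (hc : ∀ ω, IsCadlag fun t => X t ω) (hb : b₀ ≤ b)
    (hsmall : K ^ 3 * π.real (Set.Iio (-b)) ≤ k) (u v : ℝ≥0) (huv : u + 1 / 2 = v) :
    k / 4 * (π.real (Set.Iio (-b)) * π.real (Set.Ioi b)) ≤ μ.real (jumpEvent X b u v) := by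
  subst huv
  have h1 := hX.le_measureReal_jumpEvent (u := u) (h := 1 / 2) hr hc hb (by positivity)
    (by rw [← NNReal.coe_le_coe]; norm_num)
  have hK := hr.upper_pos
  set p := π.real (Set.Iio (-b))
  set p' := π.real (Set.Ioi b)
  have hp : 0 ≤ p := measureReal_nonneg
  have hp' : 0 ≤ p' := measureReal_nonneg
  have hp1 : p' ≤ 1 := measureReal_le_one
  have h2 : K ^ 3 * (p * p') ≤ k := by
    calc K ^ 3 * (p * p') = (K ^ 3 * p) * p' := by ring
      _ ≤ (K ^ 3 * p) * 1 := by gcongr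
      _ ≤ k := by linarith
  have h3 : K ^ 3 * (p * p') ^ 2 ≤ k * (p * p') := by
    calc K ^ 3 * (p * p') ^ 2 = (K ^ 3 * (p * p')) * (p * p') := by ring
      _ ≤ _ := by gcongr
  push_cast at h1
  linarith

/-- Big jumps in the unit interval are mixing with the later big jumps, without any gap. -/
lemma measureReal_jumpEvent_inter_split_le (hX : IsStationaryMarkov X μ π r)
    (hr : RatioBounds r b₀ k K) (hc : ∀ ω, IsCadlag fun t => X t ω) (hb : b₀ ≤ b)
    (hsmall : K ^ 3 * π.real (Set.Iio (-b)) ≤ k) (hsmall' : K * π.real (Set.Iio (-b)) ≤ 1 / 2)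
    {B B₀ B₁ : Set Ω} (hB₀ : MeasurableSet[fut X 2] B₀) (hB₁ : MeasurableSet[fut X 2] B₁)
    (hB : B = (B₀ ∩ (jumpEvent X b 1 2)ᶜ) ∪ (B₁ ∩ jumpEvent X b 1 2)) :
    μ.real (jumpEvent X b 0 1 ∩ B) ≤
      (4 * K + 8 * K ^ 4 / k ^ 3) * μ.real (jumpEvent X b 0 1) * μ.real B := by
  have hK := hr.upper_pos
  have hk := hr.lower_pos
  have half : (0 : ℝ≥0) < 1 / 2 := by positivity
  have t1 : (0 : ℝ≥0) + 1 / 2 = 1 / 2 := by ring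
  have t2 : (1 / 2 : ℝ≥0) + 1 / 2 = 1 := by rw [← NNReal.coe_inj]; norm_num
  have t3 : (1 : ℝ≥0) + 1 / 2 = 3 / 2 := by rw [← NNReal.coe_inj]; norm_num
  have t4 : (3 / 2 : ℝ≥0) + 1 / 2 = 2 := by rw [← NNReal.coe_inj]; norm_num
  have t5 : (1 : ℝ≥0) + 1 = 2 := by norm_num
  have l01 : (0 : ℝ≥0) ≤ 1 / 2 := zero_le
  have l12 : (1 / 2 : ℝ≥0) ≤ 1 := by rw [← NNReal.coe_le_coe]; norm_num
  have l23 : (1 : ℝ≥0) ≤ 3 / 2 := t3 ▸ le_self_add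
  have l34 : (3 / 2 : ℝ≥0) ≤ 2 := by rw [← NNReal.coe_le_coe]; norm_num
  set E₁ := jumpEvent X b 0 (1 / 2) with hE₁
  set E₂ := jumpEvent X b (1 / 2) 1 with hE₂
  set D₁ := jumpEvent X b 1 (3 / 2) with hD₁
  set D₂ := jumpEvent X b (3 / 2) 2 with hD₂
  set J := jumpEvent X b 1 2 with hJ
  have hE : jumpEvent X b 0 1 = E₁ ∪ E₂ := jumpEvent_union l01 l12
  have hD : J = D₁ ∪ D₂ := jumpEvent_union l23 l34
  have mE₁ : MeasurableSet[past X (1 / 2)] E₁ := by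
    have := measurableSet_jumpEvent_past (b := b) (u := 0) hc half
    rwa [t1] at this
  have mE₂ : MeasurableSet[past X 1] E₂ := by
    have := measurableSet_jumpEvent_past (b := b) (u := 1 / 2) hc half
    rwa [t2] at this
  have mD₁p : MeasurableSet[past X (3 / 2)] D₁ := by
    have := measurableSet_jumpEvent_past (b := b) (u := 1) hc half
    rwa [t3] at this
  have mD₂f : MeasurableSet[fut X (3 / 2)] D₂ := by
    have := measurableSet_jumpEvent_fut (b := b) (u := 3 / 2) hc half
    rwa [t4] at this
  have mJf : MeasurableSet[fut X 1] J := by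
    have := measurableSet_jumpEvent_fut (b := b) (u := 1) hc one_pos
    rwa [t5] at this
  have mB : MeasurableSet[fut X 1] B := by
    have h12 : (1 : ℝ≥0) ≤ 2 := l23.trans l34
    rw [hB]
    exact ((fut_anti h12 _ hB₀).inter mJf.compl).union ((fut_anti h12 _ hB₁).inter mJf)
  have subE₁ : μ.real E₁ ≤ μ.real (jumpEvent X b 0 1) :=
    measureReal_mono (hE ▸ Set.subset_union_left)
  have subE₂ : μ.real E₂ ≤ μ.real (jumpEvent X b 0 1) :=
    measureReal_mono (hE ▸ Set.subset_union_right)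
  have sub₀ : μ.real (B₀ ∩ Jᶜ) ≤ μ.real B := measureReal_mono (hB ▸ Set.subset_union_left)
  have sub₁ : μ.real (B₁ ∩ J) ≤ μ.real B := measureReal_mono (hB ▸ Set.subset_union_right)
  set a := μ.real (jumpEvent X b 0 1)
  set β := μ.real B
  have ha : 0 ≤ a := measureReal_nonneg
  have hβ : 0 ≤ β := measureReal_nonneg
  -- jumps in the first half
  have b₁ : μ.real (E₁ ∩ B) ≤ K * a * β := by
    refine (hX.measureReal_inter_le_of_gap hr t2.le mE₁ mB).trans ?_
    gcongr
  -- no jump in the second interval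
  have b₂ : μ.real (E₂ ∩ (B₀ ∩ Jᶜ)) ≤ 2 * K * a * β := by
    have h1 : μ.real (E₂ ∩ B₀) ≤ K * μ.real E₂ * μ.real B₀ :=
      hX.measureReal_inter_le_of_gap hr (by rw [t3]; exact l34) mE₂ hB₀
    -- At most half of B₀ is lost to jumps in (1, 2], so B₀, which is separated from E₂ by a unit
    -- gap, is at most twice as likely as B₀ ∩ Jᶜ ⊆ B.
    have h2 : μ.real (J ∩ B₀) ≤ 1 / 2 * μ.real B₀ := by
      have := hX.measureReal_jumpEvent_inter_le (u := 1) (h := 1) hr hc hb one_pos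
        (by rw [t5]; exact hB₀)
      rw [t5, NNReal.coe_one, mul_one] at this
      refine this.trans ?_
      gcongr
    have h3 : μ.real B₀ ≤ μ.real (J ∩ B₀) + μ.real (B₀ ∩ Jᶜ) := by
      refine (measureReal_mono ?_).trans (measureReal_union_le _ _)
      intro ω hω
      by_cases h : ω ∈ J
      · exact Or.inl ⟨h, hω⟩
      · exact Or.inr ⟨hω, h⟩
    have h4 : μ.real B₀ ≤ 2 * β := by linarith
    calc μ.real (E₂ ∩ (B₀ ∩ Jᶜ)) ≤ μ.real (E₂ ∩ B₀) :=
          measureReal_mono (Set.inter_subset_inter_right _ Set.inter_subset_left)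
      _ ≤ K * μ.real E₂ * μ.real B₀ := h1
      _ ≤ K * a * (2 * β) := by gcongr
      _ = _ := by ring
  -- a jump in the fourth half interval
  have b₃ : μ.real (E₂ ∩ (D₂ ∩ B₁)) ≤ K * a * β := by
    refine (hX.measureReal_inter_le_of_gap hr t3.le mE₂
      (mD₂f.inter (fut_anti l34 _ hB₁))).trans ?_
    have : μ.real (D₂ ∩ B₁) ≤ β := by
      refine le_trans (measureReal_mono ?_) sub₁
      rw [hD]
      exact fun ω hω => ⟨hω.2, Or.inr hω.1⟩
    gcongr
  -- jumps in the second and third half intervals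
  have b₄ : μ.real ((E₂ ∩ D₁) ∩ B₁) ≤ 8 * K ^ 4 / k ^ 3 * a * β := by
    set P := π.real (Set.Iio (-b)) * π.real (Set.Ioi b) with hP
    have hP0 : 0 ≤ P := by positivity
    have h1 : μ.real ((E₂ ∩ D₁) ∩ B₁) ≤ K * μ.real (E₂ ∩ D₁) * μ.real B₁ :=
      hX.measureReal_inter_le_of_gap hr t4.le ((past_mono l23 _ mE₂).inter mD₁p) hB₁
    have h2 : μ.real (E₂ ∩ D₁) ≤ K ^ 3 / 4 * P ^ 2 := by
      have := hX.measureReal_jumpEvent_inter_jumpEvent_le (u := 1 / 2) (h := 1 / 2) hr hc hb half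
      rw [t2, t3] at this
      refine this.trans (le_of_eq ?_)
      push_cast
      ring
    have h3 : k / 4 * P ≤ μ.real E₂ :=
      hX.quarter_le_measureReal_jumpEvent hr hc hb hsmall _ _ t2
    have h4 : k / 4 * P ≤ μ.real D₁ :=
      hX.quarter_le_measureReal_jumpEvent hr hc hb hsmall _ _ t3
    -- The probability of B₁ alone is not controlled by that of B; the lower bound r ≥ k/2 across a
    -- gap of 1/2 controls its product with the probability of D₁.
    have h5 : k / 2 * μ.real D₁ * μ.real B₁ ≤ μ.real (D₁ ∩ B₁) := by
      have hsub : (2 : ℝ≥0) - 3 / 2 = 1 / 2 := tsub_eq_of_eq_add (by rw [add_comm]; exact t4.symm)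
      refine hX.le_measureReal_inter (s := 3 / 2) (t := 2) ?_ mD₁p hB₁ (by positivity)
        fun ω' _ ω _ => ?_
      · exact (lt_add_of_pos_right _ half).trans_eq t4
      · rw [hsub]
        refine le_trans (le_of_eq ?_) (hr.lower (1 / 2) _ _ ?_)
        · congr 1; push_cast; ring
        · exact l12
    have h6 : μ.real (D₁ ∩ B₁) ≤ β := by
      refine le_trans (measureReal_mono ?_) sub₁
      rw [hD]
      exact fun ω hω => ⟨hω.2, Or.inl hω.1⟩
    -- The P² of the double jump is exchanged for a · μ(D₁) rather than a constant, so that μ(D₁)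
    -- remains to be paired with μ(B₁) in `h9`.
    have h7 : (k / 4 * P) * (k / 4 * P) ≤ a * μ.real D₁ := by
      gcongr
      exact h3.trans subE₂
    have h8 : P ^ 2 ≤ 16 / k ^ 2 * (a * μ.real D₁) := by
      rw [div_mul_eq_mul_div, le_div_iff₀ (by positivity)]
      nlinarith
    have h9 : μ.real D₁ * μ.real B₁ ≤ 2 / k * β := by
      rw [div_mul_eq_mul_div, le_div_iff₀ hk]
      nlinarith
    calc μ.real ((E₂ ∩ D₁) ∩ B₁) ≤ K * μ.real (E₂ ∩ D₁) * μ.real B₁ := h1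
      _ ≤ K * (K ^ 3 / 4 * (16 / k ^ 2 * (a * μ.real D₁))) * μ.real B₁ := by
          have : μ.real (E₂ ∩ D₁) ≤ K ^ 3 / 4 * (16 / k ^ 2 * (a * μ.real D₁)) :=
            h2.trans (by gcongr)
          gcongr
      _ = 4 * K ^ 4 / k ^ 2 * a * (μ.real D₁ * μ.real B₁) := by ring
      _ ≤ 4 * K ^ 4 / k ^ 2 * a * (2 / k * β) := by gcongr
      _ = _ := by field_simp; ring
  have hcover : jumpEvent X b 0 1 ∩ B ⊆
      (E₁ ∩ B) ∪ (E₂ ∩ (B₀ ∩ Jᶜ)) ∪ (E₂ ∩ (D₂ ∩ B₁)) ∪ ((E₂ ∩ D₁) ∩ B₁) := by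
    rw [hE]
    rintro ω ⟨h1 | h1, h2⟩
    · exact Or.inl (Or.inl (Or.inl ⟨h1, h2⟩))
    · rw [hB] at h2
      rcases h2 with h2 | ⟨h2, h3⟩
      · exact Or.inl (Or.inl (Or.inr ⟨h1, h2⟩))
      · rw [hD] at h3
        rcases h3 with h3 | h3
        · exact Or.inr ⟨⟨h1, h3⟩, h2⟩
        · exact Or.inl (Or.inr ⟨h1, h3, h2⟩)
  have hsum := (measureReal_mono (μ := μ) hcover).trans (measureReal_union_le _ _)
  have hsum₂ := measureReal_union_le (μ := μ) (E₁ ∩ B ∪ E₂ ∩ (B₀ ∩ Jᶜ)) (E₂ ∩ (D₂ ∩ B₁))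
  have hsum₃ := measureReal_union_le (μ := μ) (E₁ ∩ B) (E₂ ∩ (B₀ ∩ Jᶜ))
  calc _ ≤ K * a * β + 2 * K * a * β + K * a * β + 8 * K ^ 4 / k ^ 3 * a * β := by linarith
    _ = _ := by ring

end IsStationaryMarkov

/-! ### From probabilities to conditional probabilities -/

section CondExp

variable {Ω : Type*} {m : MeasurableSpace Ω} [m0 : MeasurableSpace Ω] {μ : Measure Ω}
  [IsProbabilityMeasure μ] {B : Set Ω} {η : ℝ}

/-- The hypothesis bounds the integral of the conditional probability over every `m`-measurable set;
comparison with constants on the trimmed measure makes the bounds pointwise. -/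
lemma ae_abs_condExp_sub_le (hm : m ≤ m0) (hB : MeasurableSet B)
    (h : ∀ G, MeasurableSet[m] G →
      |μ.real (G ∩ B) - μ.real G * μ.real B| ≤ η * μ.real G * μ.real B) :
    ∀ᵐ ω ∂μ, |(μ[B.indicator (fun _ => (1 : ℝ)) | m]) ω - μ.real B| ≤ η * μ.real B := by
  set g := μ[B.indicator (fun _ => (1 : ℝ)) | m] with hg
  have hgm : StronglyMeasurable[m] g := stronglyMeasurable_condExp
  have hgi : Integrable g μ := integrable_condExp
  have hgt : Integrable g (μ.trim hm) := hgi.trim hm hgm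
  have hset : ∀ G, MeasurableSet[m] G → ∫ ω in G, g ω ∂(μ.trim hm) = μ.real (G ∩ B) := by
    intro G hG
    rw [← setIntegral_trim hm hgm hG, hg,
      setIntegral_condExp hm ((integrable_const _).indicator hB) hG, integral_indicator hB,
      setIntegral_const, smul_eq_mul, mul_one, measureReal_restrict_apply hB, Set.inter_comm]
  have hconst : ∀ (c : ℝ) G, MeasurableSet[m] G →
      ∫ _ in G, c ∂(μ.trim hm) = μ.real G * c := by
    intro c G hG
    rw [setIntegral_const, smul_eq_mul, measureReal_def, trim_measurableSet_eq hm hG,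
      ← measureReal_def]
  have h1 : g ≤ᵐ[μ.trim hm] fun _ => (1 + η) * μ.real B := by
    refine ae_le_of_forall_setIntegral_le hgt (integrable_const _) fun G hG _ => ?_
    rw [hset G hG, hconst _ G hG]
    have := (abs_le.1 (h G hG)).2
    linarith
  have h2 : (fun _ => (1 - η) * μ.real B) ≤ᵐ[μ.trim hm] g := by
    refine ae_le_of_forall_setIntegral_le (integrable_const _) hgt fun G hG _ => ?_
    rw [hset G hG, hconst _ G hG]
    have := (abs_le.1 (h G hG)).1
    linarith
  filter_upwards [ae_le_of_ae_le_trim h1, ae_le_of_ae_le_trim h2] with ω hω1 hω2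
  rw [abs_le]
  constructor <;> linarith

/-- The sets of the stated form already constitute a σ-algebra, and it contains `S` and `m'`. -/
lemma exists_split_of_measurableSet_sup {m' : MeasurableSpace Ω} {S : Set Ω}
    (hB : MeasurableSet[MeasurableSpace.generateFrom {S} ⊔ m'] B) :
    ∃ B₀ B₁, MeasurableSet[m'] B₀ ∧ MeasurableSet[m'] B₁ ∧ B = (B₀ ∩ Sᶜ) ∪ (B₁ ∩ S) := by
  let m'' : MeasurableSpace Ω :=
    { MeasurableSet' := fun B => ∃ B₀ B₁, MeasurableSet[m'] B₀ ∧ MeasurableSet[m'] B₁ ∧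
        B = (B₀ ∩ Sᶜ) ∪ (B₁ ∩ S)
      measurableSet_empty := ⟨∅, ∅, MeasurableSet.empty, MeasurableSet.empty, by simp⟩
      measurableSet_compl := by
        rintro _ ⟨B₀, B₁, h₀, h₁, rfl⟩
        refine ⟨B₀ᶜ, B₁ᶜ, h₀.compl, h₁.compl, ?_⟩
        ext ω
        simp only [Set.mem_compl_iff, Set.mem_union, Set.mem_inter_iff]
        tauto
      measurableSet_iUnion := by
        intro f hf
        choose F₀ F₁ hF using hf
        refine ⟨⋃ i, F₀ i, ⋃ i, F₁ i, MeasurableSet.iUnion fun i => (hF i).1,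
          MeasurableSet.iUnion fun i => (hF i).2.1, ?_⟩
        rw [Set.iUnion_inter, Set.iUnion_inter, ← Set.iUnion_union_distrib]
        exact Set.iUnion_congr fun i => (hF i).2.2 }
  have hle : MeasurableSpace.generateFrom {S} ⊔ m' ≤ m'' := by
    refine sup_le (MeasurableSpace.generateFrom_le ?_) fun Q hQ => ⟨Q, Q, hQ, hQ, ?_⟩
    · intro Q hQ
      exact ⟨∅, Set.univ, @MeasurableSet.empty _ m', @MeasurableSet.univ _ m', by
        rw [Set.mem_singleton_iff.1 hQ]; simp⟩
    · rw [← Set.inter_union_distrib_left, Set.compl_union_self, Set.inter_univ]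
  exact hle B hB

end CondExp

/-! ### The jump indicators -/

section JumpInd

variable {Ω : Type*} {q ε : ℝ} {X : ℝ≥0 → Ω → ℝ}

lemma jumpInd_succ (q : ℝ) (X : ℝ≥0 → Ω → ℝ) (ε : ℝ) (i : ℕ) :
    jumpInd q X ε (i + 1) = (jumpEvent X (endpt q - ε) i (i + 1)).indicator fun _ => 1 := by
  have h : {ω | 1 ≤ bigJumps q X ε (((i + 1 : ℕ) : ℝ≥0) - 1) (i + 1 : ℕ) ω} =
      jumpEvent X (endpt q - ε) i (i + 1) := by
    ext ω
    have e : ((i + 1 : ℕ) : ℝ≥0) - 1 = i := by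
      push_cast
      exact add_tsub_cancel_right _ _
    have e' : -(endpt q - ε) = -endpt q + ε := by ring
    rw [Set.mem_ofPred_eq, bigJumps, e, Set.one_le_encard_iff_nonempty]
    simp only [jumpEvent, HasJump, Set.mem_ofPred_eq, e']
    push_cast
    rfl
  rw [jumpInd, h]

lemma comap_jumpInd_le {m : MeasurableSpace Ω} {i : ℕ}
    (h : MeasurableSet[m] (jumpEvent X (endpt q - ε) i (i + 1))) :
    MeasurableSpace.comap (jumpInd q X ε (i + 1)) inferInstance ≤ m := by
  rw [jumpInd_succ]
  exact measurable_iff_comap_le.1 (Measurable.indicator (@measurable_const _ _ _ m _) h)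

lemma sigmaOne_le_past (hc : ∀ ω, IsCadlag fun t => X t ω) : sigmaOne q X ε ≤ past X 1 := by
  refine comap_jumpInd_le (i := 0) ?_
  have := measurableSet_jumpEvent_past (b := endpt q - ε) (u := 0) hc one_pos
  rw [zero_add] at this
  simpa using this

/-- J_{j+1} depends on the path over [j, j + 1]. Hence the gap to `past X 1` is m − 1, and there is
none for m = 1. -/
lemma sigmaFrom_le_fut (hc : ∀ ω, IsCadlag fun t => X t ω) (m : ℕ) :
    sigmaFrom q X ε (m + 1) ≤ fut X m := by
  refine iSup₂_le fun i hi => ?_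
  obtain ⟨j, rfl⟩ : ∃ j, i = j + 1 := ⟨i - 1, by have : m + 1 ≤ i := hi; omega⟩
  have hmj : (m : ℝ≥0) ≤ j := by
    have : m + 1 ≤ j + 1 := hi
    exact_mod_cast Nat.le_of_succ_le_succ this
  exact comap_jumpInd_le (fut_anti hmj _ (measurableSet_jumpEvent_fut hc one_pos))

/-- Isolating J_2 allows B to be split according to a jump in (1, 2], with both pieces described by
the future of time 2. -/
lemma sigmaFrom_two_le : sigmaFrom q X ε 2 ≤
    MeasurableSpace.generateFrom {jumpEvent X (endpt q - ε) 1 2} ⊔ sigmaFrom q X ε 3 := by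
  refine iSup₂_le fun i hi => ?_
  rcases (show 2 ≤ i from hi).eq_or_lt with rfl | hlt
  · refine le_sup_of_le_left (comap_jumpInd_le (i := 1) ?_)
    refine MeasurableSpace.measurableSet_generateFrom ?_
    norm_num
  · exact le_sup_of_le_right
      (le_biSup (fun k => MeasurableSpace.comap (jumpInd q X ε k) inferInstance)
        (show 3 ≤ i from hlt))

lemma inter_jumpEvent_of_sigmaOne {G : Set Ω} (hG : MeasurableSet[sigmaOne q X ε] G) :
    (G ∩ jumpEvent X (endpt q - ε) 0 1 = ∅ ∨
      G ∩ jumpEvent X (endpt q - ε) 0 1 = jumpEvent X (endpt q - ε) 0 1) ∧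
    (G ∩ (jumpEvent X (endpt q - ε) 0 1)ᶜ = ∅ ∨
      G ∩ (jumpEvent X (endpt q - ε) 0 1)ᶜ = (jumpEvent X (endpt q - ε) 0 1)ᶜ) := by
  obtain ⟨T, -, rfl⟩ := hG
  have e : jumpInd q X ε 1 = (jumpEvent X (endpt q - ε) 0 1).indicator fun _ => 1 := by
    have := jumpInd_succ q X ε 0
    simpa using this
  rw [e]
  set J := jumpEvent X (endpt q - ε) 0 1
  constructor
  · by_cases h : (1 : ℝ) ∈ T
    · right
      ext ω
      by_cases hω : ω ∈ J <;> simp [hω, h]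
    · left
      ext ω
      by_cases hω : ω ∈ J <;> simp [hω, h]
  · by_cases h : (0 : ℝ) ∈ T
    · right
      ext ω
      by_cases hω : ω ∈ J <;> simp [hω, h]
    · left
      ext ω
      by_cases hω : ω ∈ J <;> simp [hω, h]

variable [MeasurableSpace Ω] {μ : Measure Ω} [IsProbabilityMeasure μ]

/-- Mixing against `σ(J_1)` follows from mixing against the two atoms. -/
lemma abs_measureReal_sub_le_of_atoms {C : ℝ} {B G : Set Ω} (hC : 1 ≤ C)
    (hJ : MeasurableSet (jumpEvent X (endpt q - ε) 0 1))
    (hG : MeasurableSet[sigmaOne q X ε] G)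
    (h₁ : μ.real (jumpEvent X (endpt q - ε) 0 1 ∩ B) ≤
      C * μ.real (jumpEvent X (endpt q - ε) 0 1) * μ.real B)
    (h₀ : μ.real ((jumpEvent X (endpt q - ε) 0 1)ᶜ ∩ B) ≤
      C * μ.real (jumpEvent X (endpt q - ε) 0 1)ᶜ * μ.real B) :
    |μ.real (G ∩ B) - μ.real G * μ.real B| ≤ C * μ.real G * μ.real B := by
  obtain ⟨hi, hi'⟩ := inter_jumpEvent_of_sigmaOne hG
  set J := jumpEvent X (endpt q - ε) 0 1
  have k₁ : μ.real (G ∩ J ∩ B) ≤ C * μ.real (G ∩ J) * μ.real B := by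
    rcases hi with h | h
    · simp [h]
    · rw [h]; exact h₁
  have k₀ : μ.real (G ∩ Jᶜ ∩ B) ≤ C * μ.real (G ∩ Jᶜ) * μ.real B := by
    rcases hi' with h | h
    · simp [h]
    · rw [h]; exact h₀
  have hsum : μ.real G = μ.real (G ∩ J) + μ.real (G ∩ Jᶜ) := by
    rw [← measureReal_inter_add_sdiff hJ, Set.sdiff_eq]
  have hle : μ.real (G ∩ B) ≤ μ.real (G ∩ J ∩ B) + μ.real (G ∩ Jᶜ ∩ B) := by
    refine (measureReal_mono ?_).trans (measureReal_union_le _ _)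
    intro ω hω
    by_cases h : ω ∈ J
    · exact Or.inl ⟨⟨hω.1, h⟩, hω.2⟩
    · exact Or.inr ⟨⟨hω.1, h⟩, hω.2⟩
  have hup : μ.real (G ∩ B) ≤ C * μ.real G * μ.real B := by
    rw [hsum]; linarith
  have h0 : 0 ≤ μ.real (G ∩ B) := measureReal_nonneg
  have h1 : 0 ≤ μ.real G * μ.real B := by positivity
  rw [abs_le]
  constructor
  -- The lower side is free: μ(G ∩ B) ≥ 0 and C ≥ 1.
  · nlinarith
  · linarith

end JumpInd

/-! ### The constants of the `q`-Ornstein--Uhlenbeck process -/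

section Constants

variable {q : ℝ}

/-- Points beyond a_q/2 on opposite sides remain at distance at least a_q after clamping, which is
the separation required in `ratio_bounds`. -/
lemma ratioBounds_eratio (hq : q ∈ Set.Ioo (-1 : ℝ) 1) :
    ∃ k K : ℝ, RatioBounds (eratio q) (endpt q / 2) k K := by
  obtain ⟨c, C, hc, hC, h⟩ := ratio_bounds hq
  have ha := endpt_pos hq
  have h' : ∀ (δ : ℝ≥0) x y, _ := fun δ x y =>
    h δ δ.coe_nonneg (clamp q x) (clamp_mem hq x) (clamp q y) (clamp_mem hq y)
  refine ⟨c, C, hc, hC, by positivity, fun δ x y hδ => ?_, fun δ x y hδ => ?_,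
    fun δ x y hx hy => ?_, fun δ x y hx hy => ?_⟩
  · exact ENNReal.ofReal_le_ofReal ((h' δ x y).1 (by exact_mod_cast hδ))
  · refine ENNReal.ofReal_le_ofReal ((h' δ x y).2.1 ?_)
    have := NNReal.coe_le_coe.2 hδ
    push_cast at this
    exact this
  · exact ENNReal.ofReal_le_ofReal ((h' δ x y).2.2
      (endpt_le_abs_clamp_sub le_rfl (by linarith) hx hy)).1
  · exact ENNReal.ofReal_le_ofReal ((h' δ x y).2.2
      (endpt_le_abs_clamp_sub le_rfl (by linarith) hx hy)).2

lemma law_Ioo_pos (hq : q ∈ Set.Ioo (-1 : ℝ) 1) {l u : ℝ} (hl : -endpt q ≤ l) (hlu : l < u)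
    (hu : u ≤ endpt q) : 0 < law q (Set.Ioo l u) := by
  rw [law, withDensity_apply _ measurableSet_Ioo,
    setLIntegral_pos_iff (measurable_dens hq).ennreal_ofReal]
  have : Set.Ioo l u ⊆ Function.support (fun x => ENNReal.ofReal (dens q x)) ∩ Set.Ioo l u := by
    refine fun x hx => ⟨?_, hx⟩
    have := dens_pos hq (x := x) ⟨hl.trans_lt hx.1, hx.2.trans_le hu⟩
    simpa using this
  refine lt_of_lt_of_le ?_ (measure_mono this)
  rw [Real.volume_Ioo]
  simpa using hlu

/-- The law has no mass at or below −a_q, so its mass below −b tends to 0 as b increases to a_q. -/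
lemma exists_level (hq : q ∈ Set.Ioo (-1 : ℝ) 1) [IsProbabilityMeasure (law q)] {η : ℝ}
    (hη : 0 < η) :
    ∃ b₁ ∈ Set.Ico (endpt q / 2) (endpt q), (law q).real (Set.Iio (-b₁)) ≤ η := by
  have ha := endpt_pos hq
  have hlim : Tendsto (fun m : ℕ => (law q) (Set.Iio (-endpt q + 1 / ((m : ℝ) + 1)))) atTop
      (𝓝 ((law q) (⋂ m : ℕ, Set.Iio (-endpt q + 1 / ((m : ℝ) + 1))))) := by
    refine tendsto_measure_iInter_atTop (fun m => measurableSet_Iio.nullMeasurableSet) ?_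
      ⟨0, measure_ne_top _ _⟩
    intro m m' hm
    refine Set.Iio_subset_Iio ?_
    have : (m : ℝ) ≤ m' := by exact_mod_cast hm
    gcongr
  have hnull : (law q) (⋂ m : ℕ, Set.Iio (-endpt q + 1 / ((m : ℝ) + 1))) = 0 := by
    refine measure_mono_null (fun x hx => ?_) (law_Ioo_compl hq)
    have hx' : x ≤ -endpt q := by
      by_contra! hlt
      obtain ⟨m, hm⟩ := exists_nat_one_div_lt (sub_pos.2 hlt)
      have := Set.mem_iInter.1 hx m
      rw [Set.mem_Iio] at this
      linarith
    exact fun h => absurd h.1 (not_lt.2 hx')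
  rw [hnull] at hlim
  have h1 := hlim.eventually_lt_const (ENNReal.ofReal_pos.2 hη)
  have h2 : ∀ᶠ m : ℕ in atTop, 1 / ((m : ℝ) + 1) < endpt q / 2 :=
    tendsto_one_div_add_atTop_nhds_zero_nat.eventually_lt_const (by positivity)
  obtain ⟨m, hm1, hm2⟩ := (h1.and h2).exists
  have hm0 : 0 < 1 / ((m : ℝ) + 1) := Nat.one_div_pos_of_nat
  refine ⟨endpt q - 1 / ((m : ℝ) + 1), ⟨by linarith, by linarith⟩, ?_⟩
  refine ENNReal.toReal_le_of_le_ofReal hη.le ?_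
  have e : -(endpt q - 1 / ((m : ℝ) + 1)) = -endpt q + 1 / ((m : ℝ) + 1) := by ring
  rw [e]
  exact hm1.le

lemma mixConst_nonneg (hq : q ∈ Set.Ioo (-1 : ℝ) 1) : 0 ≤ mixConst q := by
  have h : 0 < 1 - |q| := by linarith [abs_q_lt_one hq]
  unfold mixConst
  positivity

variable {Ω : Type*} [MeasurableSpace Ω] {X : ℝ≥0 → Ω → ℝ} {μ : Measure Ω}
  [IsProbabilityMeasure μ]

/-- Mixing across a gap of length at least one. -/
lemma IsQOUProcess.abs_measureReal_inter_sub_le (hq : q ∈ Set.Ioo (-1 : ℝ) 1)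
    (hX : IsQOUProcess q X μ) {s t : ℝ≥0} (hst : s + 1 ≤ t) {G H : Set Ω}
    (hG : MeasurableSet[past X s] G) (hH : MeasurableSet[fut X t] H) :
    |μ.real (G ∩ H) - μ.real G * μ.real H| ≤
      mixConst q * Real.exp (-(t - s : ℝ≥0)) * μ.real G * μ.real H := by
  have hprob := hX.isProbabilityMeasure_law
  have hδ : (1 : ℝ) ≤ (t - s : ℝ≥0) := by exact_mod_cast le_tsub_of_add_le_left hst
  have hb : ∀ x y, |rat q (t - s : ℝ≥0) x y - 1| ≤ mixConst q * Real.exp (-(t - s : ℝ≥0)) :=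
    fun x y => abs_ratio_sub_one_le hq hδ (clamp_mem hq x) (clamp_mem hq y)
  refine (hX.isStationaryMarkov hq).abs_measureReal_inter_sub_le
    (mul_nonneg (mixConst_nonneg hq) (Real.exp_pos _).le)
    (lt_of_lt_of_le (lt_add_of_pos_right s one_pos) hst) (fun x y => ?_) (fun x y => ?_) hG hH
  · exact ENNReal.ofReal_le_ofReal (by linarith [(abs_le.1 (hb x y)).1])
  · exact ENNReal.ofReal_le_ofReal (by linarith [(abs_le.1 (hb x y)).2])

/-- The two atoms of `σ(J_1)` are mixing with the later jump indicators, without a gap. -/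
lemma exists_const_atoms (hq : q ∈ Set.Ioo (-1 : ℝ) 1) :
    ∃ C : ℝ, 1 ≤ C ∧ ∀ (Ω : Type*) [MeasurableSpace Ω] (μ : Measure Ω) [IsProbabilityMeasure μ]
      (X : ℝ≥0 → Ω → ℝ), IsQOUProcess q X μ → ∀ ε : ℝ, 0 < ε → ε < endpt q →
      ∀ B : Set Ω, MeasurableSet[sigmaFrom q X ε 2] B →
        μ.real (jumpEvent X (endpt q - ε) 0 1 ∩ B) ≤
          C * μ.real (jumpEvent X (endpt q - ε) 0 1) * μ.real B ∧
        μ.real ((jumpEvent X (endpt q - ε) 0 1)ᶜ ∩ B) ≤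
          C * μ.real (jumpEvent X (endpt q - ε) 0 1)ᶜ * μ.real B := by
  -- The constant is chosen before the process. If `law q` were not a probability measure there
  -- would be no process, and any constant would do.
  by_cases hprob : IsProbabilityMeasure (law q)
  swap
  · exact ⟨1, le_rfl, fun Ω _ μ _ X hX => absurd hX.isProbabilityMeasure_law hprob⟩
  obtain ⟨k, K, hr⟩ := ratioBounds_eratio hq
  have hk := hr.lower_pos
  have hK := hr.upper_pos
  have ha := endpt_pos hq
  -- The two terms of the minimum are the two smallness thresholds of
  -- `measureReal_jumpEvent_inter_split_le`.
  obtain ⟨b₁, ⟨hb₁, hb₁'⟩, hsmall⟩ := exists_level hq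
    (show 0 < min (k / K ^ 3) (1 / 2 / K) by positivity)
  have hs₁ : ∀ b, b₁ ≤ b → K ^ 3 * (law q).real (Set.Iio (-b)) ≤ k := fun b hb => by
    have h1 : (law q).real (Set.Iio (-b)) ≤ k / K ^ 3 :=
      (measureReal_mono (Set.Iio_subset_Iio (by linarith))).trans
        (hsmall.trans (min_le_left _ _))
    rw [le_div_iff₀ (by positivity)] at h1
    linarith
  have hs₂ : ∀ b, b₁ ≤ b → K * (law q).real (Set.Iio (-b)) ≤ 1 / 2 := fun b hb => by
    have h1 : (law q).real (Set.Iio (-b)) ≤ 1 / 2 / K :=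
      (measureReal_mono (Set.Iio_subset_Iio (by linarith))).trans
        (hsmall.trans (min_le_right _ _))
    rw [le_div_iff₀ hK] at h1
    linarith
  set P := (law q).real (Set.Iio (-b₁)) * (law q).real (Set.Ioi b₁) with hP
  have hP0 : 0 < P := by
    refine mul_pos ?_ ?_
    · refine ENNReal.toReal_pos (ne_of_gt ?_) (measure_ne_top _ _)
      exact (law_Ioo_pos hq le_rfl (by linarith : -endpt q < -b₁) (by linarith)).trans_le
        (measure_mono fun x hx => hx.2)
    · refine ENNReal.toReal_pos (ne_of_gt ?_) (measure_ne_top _ _)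
      exact (law_Ioo_pos hq (by linarith) hb₁' le_rfl).trans_le (measure_mono fun x hx => hx.1)
  have hpos : law q (Set.Ioi 0) ≠ 0 := by
    refine ne_of_gt ((law_Ioo_pos hq (by linarith) ha le_rfl).trans_le
      (measure_mono fun x hx => hx.1))
  set c := (stayProb (law q) (eratio q)).toReal with hc
  have hc0 : 0 ≤ c := ENNReal.toReal_nonneg
  -- The summands after 1 serve the jump atom with b ≥ b₁, the jump atom with b < b₁, and the atom
  -- without a jump. At this stage only c ≥ 0 is known; its positivity follows once a process is
  -- given.
  refine ⟨1 + (4 * K + 8 * K ^ 4 / k ^ 3) + 4 / (k * P) + 1 / c, ?_, ?_⟩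
  · have : 0 ≤ (4 * K + 8 * K ^ 4 / k ^ 3) + 4 / (k * P) + 1 / c := by positivity
    linarith
  intro Ω _ μ _ X hX ε hε hεa B hB
  have hS := hX.isStationaryMarkov hq
  set b := endpt q - ε with hb
  have hb0 : 0 ≤ b := by linarith
  have hn : ∀ S : Set Ω, 0 ≤ μ.real S := fun S => measureReal_nonneg
  have hC : ∀ (C₀ : ℝ) (S : Set Ω), C₀ ≤ 1 + (4 * K + 8 * K ^ 4 / k ^ 3) + 4 / (k * P) + 1 / c →
      C₀ * μ.real S * μ.real B ≤
        (1 + (4 * K + 8 * K ^ 4 / k ^ 3) + 4 / (k * P) + 1 / c) * μ.real S * μ.real B :=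
    fun C₀ S h => by gcongr
  have p₁ : 0 ≤ 4 * K + 8 * K ^ 4 / k ^ 3 := by positivity
  have p₂ : 0 ≤ 4 / (k * P) := by positivity
  have p₃ : 0 ≤ 1 / c := by positivity
  have hofle : ∀ {S : Set Ω} {x : ℝ}, 0 < x → x ≤ μ.real S →
      μ.real (S ∩ B) ≤ 1 / x * μ.real S * μ.real B := fun {S x} hx hxS => by
    calc μ.real (S ∩ B) ≤ μ.real B := measureReal_mono Set.inter_subset_right
      _ = 1 / x * x * μ.real B := by field_simp
      _ ≤ _ := by gcongr
  constructor
  · rcases le_or_gt b₁ b with hle | hlt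
    · obtain ⟨B₀, B₁, h₀, h₁, hsplit⟩ := exists_split_of_measurableSet_sup (sigmaFrom_two_le _ hB)
      have h3 : sigmaFrom q X ε 3 ≤ fut X 2 := by
        simpa using sigmaFrom_le_fut (q := q) (ε := ε) hX.cadlag 2
      exact (hS.measureReal_jumpEvent_inter_split_le hr hX.cadlag (hb₁.trans hle) (hs₁ b hle)
        (hs₂ b hle) (h3 _ h₀) (h3 _ h₁) hsplit).trans (hC _ _ (by linarith))
    · have t1 : (0 : ℝ≥0) + 1 / 2 = 1 / 2 := by ring
      have l1 : (1 / 2 : ℝ≥0) ≤ 1 := by rw [← NNReal.coe_le_coe]; norm_num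
      -- Lowering the level enlarges the jump event, so the lower bound at level b₁ persists.
      have hlow : k / 4 * P ≤ μ.real (jumpEvent X b 0 1) := by
        refine (hS.quarter_le_measureReal_jumpEvent hr hX.cadlag hb₁ (hs₁ b₁ le_rfl) _ _
          t1).trans (measureReal_mono ?_)
        rw [jumpEvent_union (zero_le : (0 : ℝ≥0) ≤ 1 / 2) l1]
        exact fun ω hω => Or.inl (HasJump.mono_level hlt.le hω)
      refine (hofle (by positivity) hlow).trans (hC _ _ ?_)
      have : 1 / (k / 4 * P) = 4 / (k * P) := by field_simp
      linarith
  · have hcpos : 0 < c := ENNReal.toReal_pos (hS.stayProb_pos hX.cadlag hpos).ne'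
      (ne_top_of_le_ne_top (measure_ne_top _ _) (hS.stayProb_le hX.cadlag le_rfl))
    have hlow : c ≤ μ.real (jumpEvent X b 0 1)ᶜ :=
      ENNReal.toReal_mono (measure_ne_top _ _) (hS.stayProb_le hX.cadlag hb0)
    exact (hofle hcpos hlow).trans (hC _ _ (by linarith))

/-- `ψ`-mixing of the jump indicators with a gap. -/
lemma IsQOUProcess.ae_abs_condExp_sub_le_of_two_le (hq : q ∈ Set.Ioo (-1 : ℝ) 1)
    (hX : IsQOUProcess q X μ) {ε : ℝ} {m : ℕ} (hm : 2 ≤ m) {B : Set Ω}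
    (hB : MeasurableSet[sigmaFrom q X ε (m + 1)] B) :
    ∀ᵐ ω ∂μ, |(μ[B.indicator (fun _ => (1 : ℝ)) | sigmaOne q X ε]) ω - μ.real B| ≤
      mixConst q * Real.exp 1 * Real.exp (-(m : ℝ)) * μ.real B := by
  have hprob := hX.isProbabilityMeasure_law
  have hS := hX.isStationaryMarkov hq
  have hBf := sigmaFrom_le_fut hX.cadlag m _ hB
  refine ae_abs_condExp_sub_le ((sigmaOne_le_past hX.cadlag).trans (hS.past_le 1))
    (hS.fut_le _ _ hBf) fun G hG => ?_
  have h12 : (1 : ℝ≥0) + 1 ≤ m := by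
    have : (2 : ℝ≥0) ≤ m := by exact_mod_cast hm
    refine le_trans (le_of_eq ?_) this
    norm_num
  refine (hX.abs_measureReal_inter_sub_le hq h12 (sigmaOne_le_past hX.cadlag _ hG)
    hBf).trans (le_of_eq ?_)
  -- The gap is m − 1 rather than m, which accounts for the factor e.
  have e : Real.exp (-((m - 1 : ℝ≥0) : ℝ)) = Real.exp 1 * Real.exp (-(m : ℝ)) := by
    rw [← Real.exp_add, NNReal.coe_sub (le_self_add.trans h12)]
    congr 1
    push_cast
    ring
  rw [e]
  ring

end Constants

end QOU

end

theorem lemma3p2 (q : ℝ) (hq : q ∈ Set.Ioo (-1 : ℝ) 1) :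
    ∃ C : ℝ,
      (∀ t : ℝ, 1 ≤ t → ∀ x ∈ Set.Ioo (-QOU.endpt q) (QOU.endpt q),
        ∀ y ∈ Set.Ioo (-QOU.endpt q) (QOU.endpt q),
          |QOU.transDens q 0 t x y / QOU.dens q y - 1| ≤ C * Real.exp (-t)) ∧
      (∀ (Ω : Type*) [MeasurableSpace Ω] (μ : Measure Ω) [IsProbabilityMeasure μ]
        (X : ℝ≥0 → Ω → ℝ), QOU.IsQOUProcess q X μ →
        ∀ ε : ℝ, 0 < ε → ∀ m : ℕ, 1 ≤ m → (ε < QOU.endpt q ∨ 2 ≤ m) →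
        ∀ B : Set Ω, MeasurableSet[QOU.sigmaFrom q X ε (m + 1)] B →
          ∀ᵐ ω ∂μ, |(μ[B.indicator (fun _ => (1 : ℝ)) | QOU.sigmaOne q X ε]) ω - μ.real B|
            ≤ C * Real.exp (-(m : ℝ)) * μ.real B) := by
  have hM := QOU.mixConst_nonneg hq
  have he : 1 ≤ Real.exp 1 := Real.one_le_exp zero_le_one
  obtain ⟨C₁, hC₁, hatoms⟩ := QOU.exists_const_atoms hq
  -- The factor e makes up for the gap m − 1 when m ≥ 2 and cancels e^{-m} when m = 1.
  refine ⟨(QOU.mixConst q + C₁) * Real.exp 1, fun t ht x hx y hy => ?_, ?_⟩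
  · refine (QOU.abs_transDens_div_dens_sub_one_le hq ht hx hy).trans ?_
    gcongr
    nlinarith
  intro Ω _ μ _ X hX ε hε m hm hεm B hB
  by_cases hm2 : 2 ≤ m
  · filter_upwards [hX.ae_abs_condExp_sub_le_of_two_le hq hm2 hB] with ω hω
    refine hω.trans ?_
    gcongr
    linarith
  · obtain rfl : m = 1 := by omega
    have hεa : ε < QOU.endpt q := hεm.resolve_right hm2
    have hprob := hX.isProbabilityMeasure_law
    have hS := hX.isStationaryMarkov hq
    obtain ⟨h₁, h₀⟩ := hatoms Ω μ X hX ε hε hεa B hB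
    have hJ : MeasurableSet (QOU.jumpEvent X (QOU.endpt q - ε) 0 1) := by
      have := QOU.measurableSet_jumpEvent (b := QOU.endpt q - ε) (u := 0) (h := 1) hX.cadlag
        one_pos fun t _ => hX.measurable t
      simpa using this
    have hmain := QOU.ae_abs_condExp_sub_le (η := C₁)
      ((QOU.sigmaOne_le_past hX.cadlag).trans (hS.past_le 1))
      (hS.fut_le _ _ (QOU.sigmaFrom_le_fut hX.cadlag 1 _ hB))
      fun G hG => QOU.abs_measureReal_sub_le_of_atoms hC₁ hJ hG h₁ h₀
    filter_upwards [hmain] with ω hω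
    refine hω.trans ?_
    have e : (QOU.mixConst q + C₁) * Real.exp 1 * Real.exp (-((1 : ℕ) : ℝ)) =
        QOU.mixConst q + C₁ := by
      rw [mul_assoc, ← Real.exp_add]
      simp
    rw [e]
    gcongr
    linarith
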